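/- Let $n\ge 2$ be an integer and let $\omega_n$ denote the ($n$-dimensional) volume of the unit sphere in $\mathbb{R}^{n+1}$. Let $K\in C^1(\mathbb{R}^n)$ be a real-valued function such that $x\cdot\nabla K(x)\le 0$ for all $x\in\mathbb{R}^n$, and such that $K$ satisfies the polynomial cone condition (PCC): there exist $R_1>0$, $\theta>0$, $\gamma\ge n$, $c_1>0$, $c_2>0$ and a solid circular cone $C_\theta\subset\mathbb{R}^n$ with vertex at the origin and angle $\theta$ such that $|K(x)|\le c_2|x|^\gamma$ for all $|x|\ge R_1$, and $|K(x)|\ge c_1|x|^\gamma$ for all $x\in C_\theta$ with $|x|\ge R_1$. Then there is no function $w\in L^\infty_{loc}(\mathbb{R}^n)$ that is bounded from above (that is, $w\le C$ a.e. for some constant $C$), satisfies $Ke^{nw}\in L^1(\mathbb{R}^n)$, and solves the integral equation $$w(x)=\frac{2}{\omega_n}\int_{\mathbb{R}^n}\log\left(\frac{|y|}{|x-y|}\right)K(y)\,e^{nw(y)}\,dy\qquad\text{for a.e. }x\in\mathbb{R}^n .$$ -/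

import Mathlib

open MeasureTheory Set

/-- `ω_n`, the `n`-dimensional volume (surface measure) of the unit sphere in `ℝ^(n+1)`. -/
noncomputable def unitSphereVolume (n : ℕ) : ℝ :=
  (volume : Measure (EuclideanSpace ℝ (Fin (n + 1)))).toSphere.real univ

/-- The open solid circular cone with vertex at the origin, axis direction `e` and
aperture `θ`, measured from the axis. -/
def solidCone {n : ℕ} (e : EuclideanSpace ℝ (Fin n)) (θ : ℝ) :
    Set (EuclideanSpace ℝ (Fin n)) :=
  {x | x ≠ 0 ∧ InnerProductGeometry.angle e x < θ}

/-- The polynomial cone condition: for some exponent `γ ≥ n`, near infinity `|K|` is at most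
`c₂ |x|^γ` everywhere, and at least `c₁ |x|^γ` on some cone with vertex at the origin. -/
def PolynomialConeCondition {n : ℕ} (K : EuclideanSpace ℝ (Fin n) → ℝ) : Prop :=
  ∃ R₁ θ γ c₁ c₂ : ℝ, 0 < R₁ ∧ 0 < θ ∧ (n : ℝ) ≤ γ ∧ 0 < c₁ ∧ 0 < c₂ ∧
    (∀ x, R₁ ≤ ‖x‖ → |K x| ≤ c₂ * ‖x‖ ^ γ) ∧
    ∃ e : EuclideanSpace ℝ (Fin n), e ≠ 0 ∧
      ∀ x ∈ solidCone e θ \ Metric.ball 0 R₁, c₁ * ‖x‖ ^ γ ≤ |K x|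

/-- `w ∈ L^∞_loc(ℝ^n)`: `w` is measurable and essentially bounded on every compact set. -/
def LocallyEssentiallyBounded {n : ℕ} (w : EuclideanSpace ℝ (Fin n) → ℝ) : Prop :=
  ∀ s : Set (EuclideanSpace ℝ (Fin n)), IsCompact s → MemLp w ⊤ (volume.restrict s)

/-- `w` solves `w(x) = (2/ω_n) ∫ log(|y|/|x-y|) K(y) e^{n w(y)} dy` for almost every `x`. -/
def SolvesIntegralEquation {n : ℕ} (K w : EuclideanSpace ℝ (Fin n) → ℝ) : Prop :=
  ∀ᵐ x, w x = 2 / unitSphereVolume n *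
    ∫ y, Real.log (‖y‖ / ‖x - y‖) * (K y * Real.exp (n * w y))

open Filter Topology Metric

section

variable {n : ℕ}

local notation "𝔼" => EuclideanSpace ℝ (Fin n)

/-! Write `f = K e^{nw}`, `c = 2/ω_n` and `a = c ∫ f`. The contradiction comes from two incompatible
bounds on the normalized total mass: integrability forces `a ≥ 2`, while a Pohozaev inequality
forces `a < 2`.

Lower bound (`growth_le_total_mass`). At scale `R` the potential equals `-a log R` up to an error
that is `o(log R)` in mean over a fixed ball. Taking the ball inside the cone, Jensen's inequality
bounds the mass of `|f|` on its dilate below by about `R^(γ + n - na)`. This stays bounded only if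
`γ + n ≤ na`, and `γ ≥ n` gives `a ≥ 2`.

Decay (`log_potential_decay`, `density_decay`). Monotonicity along rays gives `K ≤ K 0`, so the
positive part of `f` is at most a constant times `e^{nw}`. Together with `a ≥ 2` this yields `w ≤ D
- a log |x|` with no loss in the exponent, hence `f` is bounded and `O(|x|^{-n})`. These two facts
make the potential of `|f|` with kernel `1/|x - y|` bounded and `O(1/|x|)`.

Upper bound (`total_mass_lt_of_radially_decreasing`). Differentiate `∫ K(x) e^{nw(lx)} dx` at `l =
1` in two ways. On the potential, symmetrizing in `x` and `y` gives `-(nc/2)(∫ f)²`. After the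
change of variables that moves the dilation onto `K`, monotonicity gives more than `-n ∫ f`. The
inequality is strict because growth on the cone prevents `K` from being constant. Working on the
whole space with dilations avoids boundary terms, and smoothing the kernel at scale `ε` justifies
the differentiation. -/

/-! ### Potentials with kernel `1/|x - y|`. -/

lemma integrableOn_inv_norm_ball (hn : 2 ≤ n) (r : ℝ) :
    IntegrableOn (fun z : 𝔼 => ‖z‖⁻¹) (ball 0 r) := by
  have : Nonempty (Fin n) := ⟨⟨0, by omega⟩⟩
  have : Nontrivial 𝔼 := inferInstance
  have key := integrableOn_fun_norm_addHaar (volume : Measure 𝔼) (f := fun t : ℝ => t⁻¹) (r := r)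
  rw [key, finrank_euclideanSpace_fin]
  -- In polar coordinates the density is `t^(n-1) * t⁻¹ = t^(n-2)`, a nonnegative power since `n ≥
  -- 2`.
  have h2 : IntegrableOn (fun y : ℝ => y ^ (n - 2)) (Ioo 0 r) :=
    ((continuous_pow (n - 2)).integrableOn_Icc (a := 0) (b := r)).mono_set Ioo_subset_Icc_self
  refine h2.congr_fun (fun y hy => ?_) measurableSet_Ioo
  have hy0 : y ≠ 0 := hy.1.ne'
  obtain ⟨m, rfl⟩ := Nat.exists_eq_add_of_le hn
  have : 2 + m - 1 = m + 1 := by omega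
  simp only [smul_eq_mul, Nat.add_sub_cancel_left, this]
  rw [pow_succ, mul_assoc, mul_inv_cancel₀ hy0, mul_one]

/-- The mass of `‖z‖⁻¹` on the unit ball. -/
noncomputable def invNormMass (n : ℕ) : ℝ :=
  ∫ z in ball (0 : EuclideanSpace ℝ (Fin n)) 1, ‖z‖⁻¹

lemma invNormMass_nonneg : 0 ≤ invNormMass n :=
  integral_nonneg fun _ => by positivity

lemma setIntegral_inv_norm_ball (hn : 2 ≤ n) {r : ℝ} (hr : 0 < r) :
    ∫ z in ball (0 : 𝔼) r, ‖z‖⁻¹ = r ^ (n - 1) * invNormMass n := by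
  have h := Measure.setIntegral_comp_smul_of_pos (volume : Measure 𝔼) (fun z : 𝔼 => ‖z‖⁻¹)
    (ball 0 1) hr
  rw [smul_unitBall_of_pos hr, finrank_euclideanSpace_fin] at h
  simp only [norm_smul, mul_inv, Real.norm_eq_abs, abs_of_pos hr, integral_const_mul,
    smul_eq_mul] at h
  change r⁻¹ * invNormMass n = _ at h
  obtain ⟨m, rfl⟩ := Nat.exists_eq_add_of_le' (show 1 ≤ n by omega)
  simp only [Nat.add_sub_cancel]
  have hr' := hr.ne'
  field_simp at h
  simp only [one_div] at h
  rw [pow_succ] at h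
  have := mul_left_cancel₀ hr' (a := r) (b := r ^ m * invNormMass (m + 1))
    (c := ∫ z in ball (0 : EuclideanSpace ℝ (Fin (m + 1))) r, ‖z‖⁻¹) (by linarith)
  exact this.symm

lemma integrableOn_inv_norm_sub (hn : 2 ≤ n) (x : 𝔼) (r : ℝ) :
    IntegrableOn (fun y : 𝔼 => ‖x - y‖⁻¹) (ball x r) := by
  have h := (integrableOn_inv_norm_ball hn r).integrable_indicator measurableSet_ball
  have h2 := h.comp_sub_left x
  rw [← integrable_indicator_iff measurableSet_ball]
  refine h2.congr (Eventually.of_forall fun y => ?_)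
  simp [indicator, dist_eq_norm, norm_sub_rev]

lemma setIntegral_inv_norm_sub (hn : 2 ≤ n) (x : 𝔼) {r : ℝ} (hr : 0 < r) :
    ∫ y in ball x r, ‖x - y‖⁻¹ = r ^ (n - 1) * invNormMass n := by
  rw [← setIntegral_inv_norm_ball hn hr, ← integral_indicator measurableSet_ball,
    ← integral_indicator measurableSet_ball,
    ← integral_sub_left_eq_self ((ball (0 : 𝔼) r).indicator _) volume x]
  refine integral_congr_ae (Eventually.of_forall fun y => ?_)
  simp [indicator, dist_eq_norm, norm_sub_rev]

/-- The potential `∫ |f(y)| / |x - y| dy` is finite and controlled by the mass of `f` and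
a bound for `f` on a ball around `x`. -/
lemma inv_norm_potential_bound (hn : 2 ≤ n) {f : 𝔼 → ℝ} (hf : Integrable f) (x : 𝔼)
    {r M : ℝ} (hr : 0 < r) (hM : ∀ᵐ y, y ∈ ball x r → |f y| ≤ M) :
    Integrable (fun y => ‖x - y‖⁻¹ * |f y|) ∧
      ∫ y, ‖x - y‖⁻¹ * |f y| ≤ M * (r ^ (n - 1) * invNormMass n) + r⁻¹ * ∫ y, |f y| := by
  have h1 : Integrable ((ball x r).indicator fun y => M * ‖x - y‖⁻¹) :=
    IntegrableOn.integrable_indicator ((integrableOn_inv_norm_sub hn x r).const_mul M)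
      measurableSet_ball
  have h2 : Integrable (fun y => r⁻¹ * |f y|) := hf.abs.const_mul _
  have hle : ∀ᵐ y, ‖x - y‖⁻¹ * |f y| ≤
      (ball x r).indicator (fun y => M * ‖x - y‖⁻¹) y + r⁻¹ * |f y| := by
    filter_upwards [hM] with y hy
    by_cases hyb : y ∈ ball x r
    · rw [indicator_of_mem hyb]
      have h3 := mul_le_mul_of_nonneg_left (hy hyb) (inv_nonneg.2 (norm_nonneg (x - y)))
      have : 0 ≤ r⁻¹ * |f y| := by positivity
      linarith
    · rw [indicator_of_notMem hyb, zero_add]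
      rw [mem_ball, dist_eq_norm, not_lt, norm_sub_rev] at hyb
      exact mul_le_mul_of_nonneg_right (inv_anti₀ hr hyb) (abs_nonneg _)
  have hmeas : AEStronglyMeasurable (fun y => ‖x - y‖⁻¹ * |f y|) volume := by
    refine AEStronglyMeasurable.mul ?_ hf.abs.aestronglyMeasurable
    exact Measurable.aestronglyMeasurable (by fun_prop)
  have hint : Integrable (fun y => ‖x - y‖⁻¹ * |f y|) := by
    refine (h1.add h2).mono' hmeas ?_
    filter_upwards [hle] with y hy
    rw [Real.norm_of_nonneg (by positivity)]
    exact hy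
  refine ⟨hint, (integral_mono_ae hint (h1.add h2) hle).trans_eq ?_⟩
  rw [integral_add' h1 h2, integral_indicator measurableSet_ball, integral_const_mul,
    integral_const_mul, setIntegral_inv_norm_sub hn x hr]

/-- If `|f(y)| ≤ C |y|^{-n}`, the potential `∫ |f(y)| / |x - y| dy` decays like `1 / |x|`. -/
lemma norm_mul_inv_norm_potential_le (hn : 2 ≤ n) {f : 𝔼 → ℝ} (hf : Integrable f) {C : ℝ}
    (hC : ∀ᵐ y, |f y| ≤ C * (‖y‖ ^ n)⁻¹) (x : 𝔼) :
    ‖x‖ * ∫ y, ‖x - y‖⁻¹ * |f y| ≤ 2 * (|C| * invNormMass n + ∫ y, |f y|) := by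
  have hA := invNormMass_nonneg (n := n)
  have hI : 0 ≤ ∫ y, |f y| := integral_nonneg fun _ => abs_nonneg _
  rcases eq_or_ne x 0 with rfl | hx
  · rw [norm_zero, zero_mul]
    positivity
  have hx0 : 0 < ‖x‖ := norm_pos_iff.2 hx
  have hr : 0 < ‖x‖ / 2 := by positivity
  -- On the ball of radius `|x|/2` about `x` one has `|y| ≥ |x|/2`. With this radius the near and
  -- far contributions both scale like `1/|x|`.
  have hb : ∀ᵐ y, y ∈ ball x (‖x‖ / 2) → |f y| ≤ |C| * ((‖x‖ / 2) ^ n)⁻¹ := by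
    filter_upwards [hC] with y hy hyb
    have h1 : ‖x‖ / 2 ≤ ‖y‖ := by
      rw [mem_ball, dist_eq_norm] at hyb
      have := norm_sub_norm_le x y
      rw [norm_sub_rev] at this
      linarith
    calc |f y| ≤ C * (‖y‖ ^ n)⁻¹ := hy
      _ ≤ |C| * (‖y‖ ^ n)⁻¹ := by gcongr; exact le_abs_self C
      _ ≤ |C| * ((‖x‖ / 2) ^ n)⁻¹ := by gcongr
  have h := (inv_norm_potential_bound hn hf x hr hb).2
  have h2 := mul_le_mul_of_nonneg_left h hx0.le
  refine h2.trans_eq ?_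
  obtain ⟨m, rfl⟩ := Nat.exists_eq_add_of_le' (show 1 ≤ n by omega)
  simp only [Nat.add_sub_cancel]
  field_simp
  ring

/-! ### Pointwise bounds for the logarithmic kernel. -/

lemma abs_log_sub_log_le {a b : ℝ} (ha : 0 < a) (hb : 0 < b) :
    |Real.log a - Real.log b| ≤ |a - b| * (a⁻¹ + b⁻¹) := by
  have h1 : Real.log a - Real.log b ≤ (a - b) * b⁻¹ := by
    rw [← Real.log_div ha.ne' hb.ne']
    have := Real.log_le_sub_one_of_pos (div_pos ha hb)
    calc _ ≤ a / b - 1 := this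
      _ = _ := by field_simp
  have h2 : Real.log b - Real.log a ≤ (b - a) * a⁻¹ := by
    rw [← Real.log_div hb.ne' ha.ne']
    have := Real.log_le_sub_one_of_pos (div_pos hb ha)
    calc _ ≤ b / a - 1 := this
      _ = _ := by field_simp
  have h3 := mul_le_mul_of_nonneg_right (le_abs_self (a - b)) (inv_nonneg.2 hb.le)
  have h4 := mul_le_mul_of_nonneg_right (neg_le_abs (a - b)) (inv_nonneg.2 ha.le)
  have h5 : 0 ≤ |a - b| * a⁻¹ := by positivity
  have h6 : 0 ≤ |a - b| * b⁻¹ := by positivity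
  rw [abs_le]
  constructor <;> linarith

lemma abs_log_le_add_inv {t : ℝ} (ht : 0 ≤ t) : |Real.log t| ≤ t + t⁻¹ := by
  rcases ht.eq_or_lt with rfl | ht
  · simp
  have h1 := Real.log_le_sub_one_of_pos ht
  have h2 := Real.log_le_sub_one_of_pos (inv_pos.2 ht)
  rw [Real.log_inv] at h2
  have : 0 < t⁻¹ := by positivity
  rw [abs_le]
  constructor <;> linarith

lemma ae_ne_point (hn : 2 ≤ n) (x : 𝔼) : ∀ᵐ y : 𝔼, y ≠ x := by
  have : Nonempty (Fin n) := ⟨⟨0, by omega⟩⟩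
  have : Nontrivial 𝔼 := inferInstance
  exact compl_mem_ae_iff.2 (measure_singleton x)

/-- Since `|y|` and `|x - y|` differ by at most `|x|`, the kernel is dominated by inverse norms, so
finiteness of the `1/|x - y|` potentials at `0` and `x` makes the logarithmic potential absolutely
convergent. -/
lemma abs_log_div_le {x y : 𝔼} (hy : y ≠ 0) (hxy : y ≠ x) :
    |Real.log (‖y‖ / ‖x - y‖)| ≤ ‖x‖ * (‖y‖⁻¹ + ‖x - y‖⁻¹) := by
  have h1 : 0 < ‖y‖ := norm_pos_iff.2 hy
  have h2 : 0 < ‖x - y‖ := norm_pos_iff.2 (sub_ne_zero.2 hxy.symm)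
  rw [Real.log_div h1.ne' h2.ne']
  refine (abs_log_sub_log_le h1 h2).trans ?_
  gcongr
  have := abs_norm_sub_norm_le (-y) (x - y)
  rw [norm_neg] at this
  refine this.trans_eq ?_
  rw [← norm_neg]
  congr 1
  abel

/-- The integrand of the logarithmic potential is integrable. -/
lemma integrable_log_kernel (hn : 2 ≤ n) {f : 𝔼 → ℝ} (hf : Integrable f)
    (hI : ∀ x, Integrable (fun y => ‖x - y‖⁻¹ * |f y|)) (x : 𝔼) :
    Integrable (fun y => Real.log (‖y‖ / ‖x - y‖) * f y) := by
  have h0 : Integrable (fun y => ‖y‖⁻¹ * |f y|) := by simpa using hI 0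
  refine ((h0.add (hI x)).const_mul ‖x‖).mono' ?_ ?_
  · refine AEStronglyMeasurable.mul ?_ hf.aestronglyMeasurable
    exact Measurable.aestronglyMeasurable (by fun_prop)
  · filter_upwards [ae_ne_point hn 0, ae_ne_point hn x] with y hy hyx
    rw [norm_mul, Real.norm_eq_abs, Real.norm_eq_abs]
    refine (mul_le_mul_of_nonneg_right (abs_log_div_le hy hyx) (abs_nonneg _)).trans_eq ?_
    simp only [Pi.add_apply]
    ring

lemma log_kernel_smul {R : ℝ} (hR : 0 < R) {z y : 𝔼} (hy : y ≠ 0) (hyz : y ≠ R • z) :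
    Real.log (‖y‖ / ‖R • z - y‖) + Real.log R = Real.log (‖y‖ / ‖z - R⁻¹ • y‖) := by
  have h1 : R • z - y = R • (z - R⁻¹ • y) := by
    rw [smul_sub, smul_smul, mul_inv_cancel₀ hR.ne', one_smul]
  have h2 : 0 < ‖R • z - y‖ := norm_pos_iff.2 (sub_ne_zero.2 hyz.symm)
  have h3 : ‖R • z - y‖ = R * ‖z - R⁻¹ • y‖ := by
    rw [h1, norm_smul, Real.norm_of_nonneg hR.le]
  have h4 : 0 < ‖z - R⁻¹ • y‖ := by
    rw [h3] at h2
    exact (mul_pos_iff_of_pos_left hR).1 h2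
  have h5 : 0 < ‖y‖ := norm_pos_iff.2 hy
  rw [h3, Real.log_div h5.ne' (by positivity), Real.log_div h5.ne' h4.ne',
    Real.log_mul hR.ne' h4.ne']
  ring

/-- Away from the singularity at `y = 0` this bound does not grow with `|y|`. After averaging in `z`
and dividing by `log R` it supplies the dominating function for the limit `R → ∞`. -/
lemma abs_log_rescaled_kernel_le {R : ℝ} (hR : 1 ≤ R) {z y : 𝔼} (hz : ‖z‖ ≤ 2) (hy : y ≠ 0)
    (hyz : z ≠ R⁻¹ • y) :
    |Real.log (‖y‖ / ‖z - R⁻¹ • y‖)| ≤ Real.log R + 2 * ‖z - R⁻¹ • y‖⁻¹ + 2 * ‖y‖⁻¹ := by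
  have hR0 : 0 < R := by linarith
  set v := R⁻¹ • y with hv
  have h1 : 0 < ‖y‖ := norm_pos_iff.2 hy
  have h2 : 0 < ‖z - v‖ := norm_pos_iff.2 (sub_ne_zero.2 hyz)
  have hyv : ‖y‖ = R * ‖v‖ := by
    rw [hv, norm_smul, norm_inv, Real.norm_of_nonneg hR0.le, ← mul_assoc,
      mul_inv_cancel₀ hR0.ne', one_mul]
  have hvn : ‖v‖ ≤ ‖z - v‖ + 2 := by
    have := norm_sub_norm_le v z
    rw [norm_sub_rev] at this
    linarith
  have hvy : ‖v‖ ≤ ‖y‖ := by rw [hyv]; nlinarith [norm_nonneg v]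
  have hlogR := Real.log_nonneg hR
  rw [Real.log_div h1.ne' h2.ne', abs_le]
  have e1 : Real.log ‖y‖ ≤ Real.log R + Real.log ‖z - v‖ + 2 * ‖z - v‖⁻¹ := by
    have a1 : Real.log ‖y‖ ≤ Real.log (R * (‖z - v‖ * (1 + 2 * ‖z - v‖⁻¹))) := by
      apply Real.log_le_log h1
      rw [hyv]
      gcongr
      refine hvn.trans_eq ?_
      field_simp
    rw [Real.log_mul hR0.ne' (by positivity), Real.log_mul h2.ne' (by positivity)] at a1
    have a2 := Real.log_le_sub_one_of_pos (show 0 < 1 + 2 * ‖z - v‖⁻¹ by positivity)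
    linarith
  have e2 : Real.log ‖z - v‖ ≤ Real.log ‖y‖ + 2 * ‖y‖⁻¹ := by
    have a1 : Real.log ‖z - v‖ ≤ Real.log (‖y‖ * (1 + 2 * ‖y‖⁻¹)) := by
      apply Real.log_le_log h2
      have : ‖y‖ * (1 + 2 * ‖y‖⁻¹) = ‖y‖ + 2 := by field_simp
      rw [this]
      have := norm_sub_le z v
      linarith
    rw [Real.log_mul h1.ne' (by positivity)] at a1
    have a2 := Real.log_le_sub_one_of_pos (show 0 < 1 + 2 * ‖y‖⁻¹ by positivity)
    linarith
  have p1 : 0 < ‖z - v‖⁻¹ := by positivity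
  have p2 : 0 < ‖y‖⁻¹ := by positivity
  constructor <;> linarith

/-- Complement to `abs_log_rescaled_kernel_le`: there is no `log R` term, so for fixed `y` the
average in `z` stays bounded in `R` and vanishes after division by `log R`. -/
lemma abs_log_rescaled_kernel_le' {R : ℝ} (hR : 1 ≤ R) {z y : 𝔼} (hz : ‖z‖ ≤ 2) (hy : y ≠ 0)
    (hyz : z ≠ R⁻¹ • y) :
    |Real.log (‖y‖ / ‖z - R⁻¹ • y‖)| ≤ (|Real.log ‖y‖| + 2 + ‖y‖) + ‖z - R⁻¹ • y‖⁻¹ := by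
  have hR0 : 0 < R := by linarith
  have h1 : 0 < ‖y‖ := norm_pos_iff.2 hy
  have h2 : 0 < ‖z - R⁻¹ • y‖ := norm_pos_iff.2 (sub_ne_zero.2 hyz)
  have hvy : ‖R⁻¹ • y‖ ≤ ‖y‖ := by
    rw [norm_smul, norm_inv, Real.norm_of_nonneg hR0.le]
    exact mul_le_of_le_one_left h1.le (inv_le_one_of_one_le₀ hR)
  rw [Real.log_div h1.ne' h2.ne']
  have := abs_sub (Real.log ‖y‖) (Real.log ‖z - R⁻¹ • y‖)
  have h3 := abs_log_le_add_inv h2.le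
  have h4 := norm_sub_le z (R⁻¹ • y)
  linarith

/-- The point is uniformity in `v`; it follows from the potential bound applied to the indicator of
the ball. -/
lemma integral_inv_norm_sub_le (hn : 2 ≤ n) (e : 𝔼) (r : ℝ) (v : 𝔼) :
    IntegrableOn (fun z => ‖z - v‖⁻¹) (ball e r) ∧
    ∫ z in ball e r, ‖z - v‖⁻¹ ≤ invNormMass n + volume.real (ball e r) := by
  have hi : Integrable ((ball e r).indicator (1 : 𝔼 → ℝ)) :=
    (integrable_indicator_iff measurableSet_ball).2 (integrableOn_const measure_ball_lt_top.ne)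
  have habs : ∀ y, |(ball e r).indicator (1 : 𝔼 → ℝ) y| = (ball e r).indicator (1 : 𝔼 → ℝ) y :=
    fun y => abs_of_nonneg (indicator_nonneg (fun _ _ => zero_le_one) y)
  have h := inv_norm_potential_bound hn hi v (M := 1) one_pos (Eventually.of_forall fun y _ => by
    rw [habs]
    exact indicator_le_self' (fun _ _ => zero_le_one) y)
  have hfun : (fun y => ‖v - y‖⁻¹ * |(ball e r).indicator (1 : 𝔼 → ℝ) y|) =
      (ball e r).indicator fun z => ‖z - v‖⁻¹ := by
    ext y
    rw [habs, norm_sub_rev]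
    by_cases hy : y ∈ ball e r <;> simp [hy]
  rw [hfun] at h
  simp only [habs] at h
  rw [integral_indicator measurableSet_ball, integral_indicator_one measurableSet_ball] at h
  refine ⟨(integrable_indicator_iff measurableSet_ball).1 h.1, h.2.trans_eq ?_⟩
  simp

/-! ### Behaviour in mean at infinity and the lower bound on the mass. -/

/-- On large balls, the logarithmic potential of `f` is `-c (∫ f) log R + o(log R)` in mean. -/
lemma tendsto_mean_log_potential (hn : 2 ≤ n) {f w : 𝔼 → ℝ} {c : ℝ} (hc : 0 < c)
    (hf : Integrable f) (hI : ∀ x, Integrable (fun y => ‖x - y‖⁻¹ * |f y|))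
    (hw : ∀ x, w x = c * ∫ y, Real.log (‖y‖ / ‖x - y‖) * f y)
    {e : 𝔼} {r : ℝ} (hB : ∀ z ∈ ball e r, ‖z‖ ≤ 2) :
    (∀ R : ℝ, 1 ≤ R → IntegrableOn (fun z => w (R • z) + c * (∫ y, f y) * Real.log R)
      (ball e r)) ∧
    Tendsto (fun R : ℝ => (Real.log R)⁻¹ *
      ∫ z in ball e r, |w (R • z) + c * (∫ y, f y) * Real.log R|) atTop (𝓝 0) := by
  set B := ball e r
  set b := volume.real B
  set A := invNormMass n + b
  have hA0 : 0 ≤ A := add_nonneg invNormMass_nonneg measureReal_nonneg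
  have hb0 : 0 ≤ b := measureReal_nonneg
  let k : ℝ → 𝔼 → 𝔼 → ℝ := fun R z y => Real.log (‖y‖ / ‖z - R⁻¹ • y‖)
  have hfin : IsFiniteMeasure (volume.restrict B) := ⟨by
    rw [Measure.restrict_apply_univ]; exact measure_ball_lt_top⟩
  have hrepr : ∀ R : ℝ, 1 ≤ R → ∀ z, w (R • z) + c * (∫ y, f y) * Real.log R =
      c * ∫ y, k R z y * f y := by
    intro R hR z
    rw [hw, mul_assoc, ← mul_add, ← integral_mul_const, ← integral_add
      (integrable_log_kernel hn hf hI _) (hf.mul_const _)]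
    congr 1
    refine integral_congr_ae ?_
    filter_upwards [ae_ne_point hn 0, ae_ne_point hn (R • z)] with y hy hyz
    rw [mul_comm (f y), ← add_mul, log_kernel_smul (by linarith) hy hyz]
  have hzmem : ∀ᵐ z ∂(volume.restrict B), z ∈ B := ae_restrict_mem measurableSet_ball
  have hzne : ∀ v : 𝔼, ∀ᵐ z ∂(volume.restrict B), z ≠ v := fun v =>
    ae_restrict_of_ae (ae_ne_point hn v)
  have hk1 : ∀ R : ℝ, 1 ≤ R → ∀ y : 𝔼, y ≠ 0 →
      IntegrableOn (fun z => |k R z y|) B ∧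
      ∫ z in B, |k R z y| ≤ Real.log R * b + 2 * A + 2 * ‖y‖⁻¹ * b ∧
      ∫ z in B, |k R z y| ≤ (|Real.log ‖y‖| + 2 + ‖y‖) * b + A := by
    intro R hR y hy
    have hJ := integral_inv_norm_sub_le hn e r (R⁻¹ • y)
    have hb1 : IntegrableOn (fun z => Real.log R + 2 * ‖z - R⁻¹ • y‖⁻¹ + 2 * ‖y‖⁻¹) B :=
      ((integrable_const _).add (hJ.1.const_mul 2)).add (integrable_const _)
    have hb2 : IntegrableOn (fun z => (|Real.log ‖y‖| + 2 + ‖y‖) + ‖z - R⁻¹ • y‖⁻¹) B :=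
      (integrable_const _).add hJ.1
    have hle1 : ∀ᵐ z ∂(volume.restrict B), |k R z y| ≤
        Real.log R + 2 * ‖z - R⁻¹ • y‖⁻¹ + 2 * ‖y‖⁻¹ := by
      filter_upwards [hzmem, hzne (R⁻¹ • y)] with z hz hzy
      exact abs_log_rescaled_kernel_le hR (hB z hz) hy hzy
    have hle2 : ∀ᵐ z ∂(volume.restrict B), |k R z y| ≤
        (|Real.log ‖y‖| + 2 + ‖y‖) + ‖z - R⁻¹ • y‖⁻¹ := by
      filter_upwards [hzmem, hzne (R⁻¹ • y)] with z hz hzy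
      exact abs_log_rescaled_kernel_le' hR (hB z hz) hy hzy
    have hint : IntegrableOn (fun z => |k R z y|) B := by
      refine Integrable.mono' hb1 (Measurable.aestronglyMeasurable (by fun_prop)) ?_
      filter_upwards [hle1] with z hz
      rwa [Real.norm_eq_abs, abs_abs]
    refine ⟨hint, (integral_mono_ae hint hb1 hle1).trans ?_,
      (integral_mono_ae hint hb2 hle2).trans ?_⟩
    · have hb3 : IntegrableOn (fun z => Real.log R + 2 * ‖z - R⁻¹ • y‖⁻¹) B :=
        (integrable_const _).add (hJ.1.const_mul 2)
      rw [integral_add hb3 (integrable_const _),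
        integral_add (integrable_const _) (hJ.1.const_mul 2), integral_const_mul,
        setIntegral_const, setIntegral_const, smul_eq_mul, smul_eq_mul]
      have := hJ.2
      change _ ≤ A at this
      change b * _ + _ + b * _ ≤ _
      linarith
    · rw [integral_add (integrable_const _) hJ.1, setIntegral_const, smul_eq_mul]
      have := hJ.2
      change _ ≤ A at this
      change b * _ + _ ≤ _
      linarith
  have hinv : Integrable (fun y => ‖y‖⁻¹ * |f y|) := by simpa using hI 0
  have hprod : ∀ R : ℝ, 1 ≤ R → Integrable (Function.uncurry fun z y => k R z y * f y)
      ((volume.restrict B).prod volume) := by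
    intro R hR
    have hmeas : AEStronglyMeasurable (Function.uncurry fun z y => k R z y * f y)
        ((volume.restrict B).prod volume) := by
      refine AEStronglyMeasurable.mul (f := fun p : 𝔼 × 𝔼 => k R p.1 p.2)
        (g := fun p : 𝔼 × 𝔼 => f p.2) ?_ hf.aestronglyMeasurable.comp_snd
      exact Measurable.aestronglyMeasurable (by fun_prop)
    rw [integrable_prod_iff' hmeas]
    constructor
    · filter_upwards [ae_ne_point hn 0] with y hy
      have := (hk1 R hR y hy).1
      refine Integrable.mul_const ?_ (f y)
      refine (integrable_norm_iff (Measurable.aestronglyMeasurable (by fun_prop))).1 ?_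
      exact this
    · have hdom : Integrable fun y => (Real.log R * b + 2 * A) * |f y| +
          2 * b * (‖y‖⁻¹ * |f y|) := (hf.abs.const_mul _).add (hinv.const_mul _)
      refine hdom.mono' hmeas.norm.prod_swap.integral_prod_right' ?_
      filter_upwards [ae_ne_point hn 0] with y hy
      have h := (hk1 R hR y hy).2.1
      rw [Real.norm_of_nonneg (integral_nonneg fun _ => norm_nonneg _)]
      simp only [Function.uncurry_apply_pair, norm_mul, Real.norm_eq_abs, integral_mul_const]
      refine (mul_le_mul_of_nonneg_right h (abs_nonneg (f y))).trans_eq (by ring)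
  have hint : ∀ R : ℝ, 1 ≤ R → IntegrableOn
      (fun z => w (R • z) + c * (∫ y, f y) * Real.log R) B := by
    intro R hR
    refine ((hprod R hR).integral_prod_left.const_mul c).congr (Eventually.of_forall fun z => ?_)
    simp only [hrepr R hR, Function.uncurry_apply_pair]
  refine ⟨hint, ?_⟩
  have hfub : ∀ R : ℝ, 1 ≤ R → ∫ z in B, |w (R • z) + c * (∫ y, f y) * Real.log R| ≤
      c * ∫ y, (∫ z in B, |k R z y|) * |f y| := by
    intro R hR
    have hp := (hprod R hR).norm
    calc ∫ z in B, |w (R • z) + c * (∫ y, f y) * Real.log R|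
        ≤ ∫ z in B, c * ∫ y, |k R z y * f y| := by
          refine integral_mono (hint R hR).abs (hp.integral_prod_left.const_mul c) fun z => ?_
          simp only [hrepr R hR, abs_mul c, abs_of_pos hc]
          gcongr
          exact abs_integral_le_integral_abs
      _ = c * ∫ z in B, ∫ y, |k R z y * f y| := integral_const_mul _ _
      _ = c * ∫ y, ∫ z in B, |k R z y * f y| := by
          congr 1
          exact integral_integral_swap hp
      _ = _ := by simp only [abs_mul, integral_mul_const]
  -- Dominated convergence in `y`: the first bound of `hk1` dominates once `log R ≥ 1`, the second
  -- gives the pointwise limit.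
  have hlim : Tendsto (fun R : ℝ => ∫ y, (Real.log R)⁻¹ * ((∫ z in B, |k R z y|) * |f y|))
      atTop (𝓝 (∫ _ : 𝔼, (0 : ℝ))) := by
    refine tendsto_integral_filter_of_dominated_convergence
      (fun y => (b + 2 * A) * |f y| + 2 * b * (‖y‖⁻¹ * |f y|)) ?_ ?_ ?_ ?_
    · refine Eventually.of_forall fun R => ?_
      refine AEStronglyMeasurable.const_mul (AEStronglyMeasurable.mul ?_
        hf.abs.aestronglyMeasurable) _
      have hm : AEStronglyMeasurable (fun p : 𝔼 × 𝔼 => |k R p.2 p.1|)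
          (volume.prod (volume.restrict B)) := Measurable.aestronglyMeasurable (by fun_prop)
      exact hm.integral_prod_right'
    · filter_upwards [eventually_ge_atTop (Real.exp 1)] with R hR
      have hlog : 1 ≤ Real.log R := by
        rw [Real.le_log_iff_exp_le ((Real.exp_pos 1).trans_le hR)]
        exact hR
      have hR1 : 1 ≤ R := (Real.one_le_exp zero_le_one).trans hR
      filter_upwards [ae_ne_point hn 0] with y hy
      have h := (hk1 R hR1 y hy).2.1
      have h0 : 0 ≤ ∫ z in B, |k R z y| := integral_nonneg fun _ => abs_nonneg _
      rw [Real.norm_of_nonneg (by positivity)]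
      rw [inv_mul_le_iff₀ (by linarith)]
      have hle : Real.log R * b + 2 * A + 2 * ‖y‖⁻¹ * b ≤
          Real.log R * (b + 2 * A + 2 * b * ‖y‖⁻¹) := by
        have : 0 ≤ 2 * A + 2 * b * ‖y‖⁻¹ := by positivity
        nlinarith
      refine (mul_le_mul_of_nonneg_right (h.trans hle) (abs_nonneg (f y))).trans_eq (by ring)
    · exact (hf.abs.const_mul _).add (hinv.const_mul _)
    · filter_upwards [ae_ne_point hn 0] with y hy
      have hz : Tendsto (fun R : ℝ => (Real.log R)⁻¹ *
          (((|Real.log ‖y‖| + 2 + ‖y‖) * b + A) * |f y|)) atTop (𝓝 0) := by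
        simpa using (tendsto_inv_atTop_zero.comp Real.tendsto_log_atTop).mul_const
          (((|Real.log ‖y‖| + 2 + ‖y‖) * b + A) * |f y|)
      refine squeeze_zero' ?_ ?_ hz
      · filter_upwards [eventually_ge_atTop 1] with R hR
        have := Real.log_nonneg hR
        have h0 : 0 ≤ ∫ z in B, |k R z y| := integral_nonneg fun _ => abs_nonneg _
        positivity
      · filter_upwards [eventually_ge_atTop 1] with R hR
        have := Real.log_nonneg hR
        have h := (hk1 R hR y hy).2.2
        gcongr
  rw [integral_zero] at hlim
  have hlim2 := hlim.const_mul c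
  rw [mul_zero] at hlim2
  refine squeeze_zero' ?_ ?_ hlim2
  · filter_upwards [eventually_ge_atTop 1] with R hR
    have := Real.log_nonneg hR
    have h0 : 0 ≤ ∫ z in B, |w (R • z) + c * (∫ y, f y) * Real.log R| :=
      integral_nonneg fun _ => abs_nonneg _
    positivity
  · filter_upwards [eventually_ge_atTop 1] with R hR
    have := Real.log_nonneg hR
    rw [integral_const_mul]
    have h := mul_le_mul_of_nonneg_left (hfub R hR) (inv_nonneg.2 this)
    linarith

/-- If `|f| = |K| e^{nw}` with `|K|` of growth `|x|^γ` on the cone over a ball, then integrability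
of `f` bounds the total mass from below. -/
lemma growth_le_total_mass (hn : 2 ≤ n) {f w : 𝔼 → ℝ} {c : ℝ} (hc : 0 < c)
    (hf : Integrable f) (hI : ∀ x, Integrable (fun y => ‖x - y‖⁻¹ * |f y|))
    (hw : ∀ x, w x = c * ∫ y, Real.log (‖y‖ / ‖x - y‖) * f y)
    {e : 𝔼} {r : ℝ} (hr : 0 < r) (hB : ∀ z ∈ ball e r, ‖z‖ ≤ 2) {γ c₁ R₁ : ℝ} (hc₁ : 0 < c₁)
    (hgrow : ∀ R : ℝ, R₁ ≤ R → ∀ z ∈ ball e r,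
      c₁ * R ^ γ * Real.exp (n * w (R • z)) ≤ |f (R • z)|) :
    γ + n ≤ n * (c * ∫ y, f y) := by
  obtain ⟨hint, hlim⟩ := tendsto_mean_log_potential hn hc hf hI hw hB
  set B := ball e r
  set a := c * ∫ y, f y
  set b := volume.real B
  set m := ∫ y, |f y|
  have hb : 0 < b := by
    rw [show b = volume.real B from rfl, Measure.real, ENNReal.toReal_pos_iff]
    exact ⟨measure_ball_pos _ _ hr, measure_ball_lt_top⟩
  have hfin : IsFiniteMeasure (volume.restrict B) := ⟨by
    rw [Measure.restrict_apply_univ]; exact measure_ball_lt_top⟩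
  set S : ℝ → ℝ := fun R => ∫ z in B, |w (R • z) + a * Real.log R|
  have key : ∀ᶠ R : ℝ in atTop, γ + n - n * a ≤
      (Real.log R)⁻¹ * (Real.log m - Real.log c₁ - Real.log b) +
        n / b * ((Real.log R)⁻¹ * S R) := by
    filter_upwards [eventually_ge_atTop R₁, eventually_gt_atTop 1] with R hR hR1
    have hR0 : 0 < R := by linarith
    have hlog : 0 < Real.log R := Real.log_pos hR1
    -- Jensen by hand: `q` is the exponential of a lower bound for the mean of `n w(Rz)` over `B`.
    -- In the tangent-line bound `1 + t ≤ e^t` based there, the linear part has nonnegative integral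
    -- over `B`.
    set q := Real.exp (-(n * a * Real.log R) - n * S R / b) with hq
    have hlow : ∀ z, q * (1 + n * (w (R • z) + a * Real.log R) + n * S R / b) ≤
        Real.exp (n * w (R • z)) := by
      intro z
      have h1 := Real.add_one_le_exp (n * (w (R • z) + a * Real.log R) + n * S R / b)
      have h2 : Real.exp (n * w (R • z)) =
          q * Real.exp (n * (w (R • z) + a * Real.log R) + n * S R / b) := by
        rw [hq, ← Real.exp_add]
        congr 1
        ring
      rw [h2]
      have := mul_le_mul_of_nonneg_left h1 (Real.exp_pos (-(n * a * Real.log R) -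
        n * S R / b)).le
      refine le_trans (le_of_eq ?_) this
      rw [hq]
      ring
    have hi1 : Integrable (fun z => n * (w (R • z) + a * Real.log R)) (volume.restrict B) :=
      (hint R hR1.le).const_mul _
    have hi2 : Integrable (fun z => 1 + n * (w (R • z) + a * Real.log R) + n * S R / b)
        (volume.restrict B) := ((integrable_const _).add hi1).add (integrable_const _)
    have hfR : Integrable (fun z => |f (R • z)|) := (hf.comp_smul hR0.ne').abs
    have hchain : c₁ * R ^ γ * (q * b) ≤ (R ^ n)⁻¹ * m := by
      calc c₁ * R ^ γ * (q * b)
          ≤ c₁ * R ^ γ * (q * ∫ z in B,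
              (1 + n * (w (R • z) + a * Real.log R) + n * S R / b)) := by
            have : b ≤ ∫ z in B, (1 + n * (w (R • z) + a * Real.log R) + n * S R / b) := by
              have hi3 : Integrable (fun z => 1 + n * (w (R • z) + a * Real.log R))
                  (volume.restrict B) := (integrable_const _).add hi1
              rw [integral_add hi3 (integrable_const _),
                integral_add (integrable_const _) hi1, integral_const_mul, setIntegral_const,
                setIntegral_const, smul_eq_mul, smul_eq_mul]
              change b ≤ b * 1 + _ + b * _
              have h1 : -S R ≤ ∫ z in B, (w (R • z) + a * Real.log R) :=
                neg_le_of_abs_le abs_integral_le_integral_abs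
              have h2 := mul_le_mul_of_nonneg_left h1 (Nat.cast_nonneg (α := ℝ) n)
              have h3 : b * (n * S R / b) = n * S R := by field_simp
              rw [h3]
              linarith
            have hq0 : 0 < q := Real.exp_pos _
            gcongr
        _ = ∫ z in B, c₁ * R ^ γ *
              (q * (1 + n * (w (R • z) + a * Real.log R) + n * S R / b)) := by
            rw [integral_const_mul, integral_const_mul]
        _ ≤ ∫ z in B, |f (R • z)| := by
            refine setIntegral_mono_on ((hi2.const_mul q).const_mul _) hfR.integrableOn
              measurableSet_ball fun z hz => ?_
            refine le_trans ?_ (hgrow R hR z hz)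
            have := hlow z
            gcongr
        _ ≤ ∫ z, |f (R • z)| :=
            setIntegral_le_integral hfR (Eventually.of_forall fun _ => abs_nonneg _)
        _ = (R ^ n)⁻¹ * m := by
            rw [Measure.integral_comp_smul_of_nonneg volume (fun z => |f z|) R (hR := hR0.le),
              finrank_euclideanSpace_fin, smul_eq_mul]
    have hq0 : 0 < q := Real.exp_pos _
    have hRγ : 0 < R ^ γ := Real.rpow_pos_of_pos hR0 γ
    have hm : 0 < m := by
      have : 0 < (R ^ n)⁻¹ * m := lt_of_lt_of_le (by positivity) hchain
      exact (mul_pos_iff_of_pos_left (by positivity)).1 this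
    have hl := Real.log_le_log (by positivity) hchain
    rw [Real.log_mul (by positivity) (by positivity), Real.log_mul hc₁.ne' hRγ.ne',
      Real.log_mul hq0.ne' hb.ne', Real.log_mul (by positivity) hm.ne', Real.log_inv,
      Real.log_pow, Real.log_rpow hR0, hq, Real.log_exp] at hl
    have h5 : n / b * ((Real.log R)⁻¹ * S R) = (Real.log R)⁻¹ * (n * S R / b) := by ring
    rw [h5, ← mul_add, ← div_eq_inv_mul, le_div_iff₀ hlog]
    linarith
  have hlim2 : Tendsto (fun R : ℝ => (Real.log R)⁻¹ * (Real.log m - Real.log c₁ - Real.log b) +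
        n / b * ((Real.log R)⁻¹ * S R)) atTop (𝓝 0) := by
    have h1 := (tendsto_inv_atTop_zero.comp Real.tendsto_log_atTop).mul_const
      (Real.log m - Real.log c₁ - Real.log b)
    have h2 := hlim.const_mul (n / b)
    simpa using h1.add h2
  have := ge_of_tendsto hlim2 key
  linarith

/-! ### Pointwise upper bound for the potential at infinity. -/

lemma log_potential_add_log_norm (hn : 2 ≤ n) {f w : 𝔼 → ℝ} {c : ℝ}
    (hf : Integrable f) (hI : ∀ x, Integrable (fun y => ‖x - y‖⁻¹ * |f y|))
    (hw : ∀ x, w x = c * ∫ y, Real.log (‖y‖ / ‖x - y‖) * f y) {x : 𝔼} (hx : x ≠ 0) :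
    Integrable (fun y => Real.log (‖x‖ * ‖y‖ / ‖x - y‖) * f y) ∧
    w x + c * (∫ y, f y) * Real.log ‖x‖ =
      c * ∫ y, Real.log (‖x‖ * ‖y‖ / ‖x - y‖) * f y := by
  have h1 := integrable_log_kernel hn hf hI x
  have h2 := hf.mul_const (Real.log ‖x‖)
  have hae : (fun y => Real.log (‖y‖ / ‖x - y‖) * f y + f y * Real.log ‖x‖) =ᵐ[volume]
      fun y => Real.log (‖x‖ * ‖y‖ / ‖x - y‖) * f y := by
    filter_upwards [ae_ne_point hn 0, ae_ne_point hn x] with y hy hyx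
    have a1 := norm_ne_zero_iff.2 hx
    have a2 := norm_ne_zero_iff.2 hy
    have a3 := norm_ne_zero_iff.2 (sub_ne_zero.2 hyx.symm)
    rw [mul_div_assoc, Real.log_mul a1 (div_ne_zero a2 a3)]
    ring
  refine ⟨(h1.add h2).congr hae, ?_⟩
  rw [hw, mul_assoc, ← mul_add, ← integral_mul_const, ← integral_add h1 h2,
    integral_congr_ae hae]

/-- For norms at least 2 the product dominates the sum. This sign is what allows the negative part
of `f`, which carries the growth of `K`, to be dropped in upper bounds. -/
lemma log_kernel_nonneg {x y : 𝔼} (hx : 2 ≤ ‖x‖) (hy : 2 ≤ ‖y‖) (hyx : y ≠ x) :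
    0 ≤ Real.log (‖x‖ * ‖y‖ / ‖x - y‖) := by
  have h2 : 0 < ‖x - y‖ := norm_pos_iff.2 (sub_ne_zero.2 hyx.symm)
  apply Real.log_nonneg
  rw [le_div_iff₀ h2, one_mul]
  have := norm_sub_le x y
  nlinarith

/-- The larger norm is at most the smaller plus `|x - y|`, so only the smaller norm enters
logarithmically. For fixed `y` the bound therefore does not grow as `|x| → ∞`. -/
lemma log_kernel_le {x y : 𝔼} (hx : 1 ≤ ‖x‖) (hy : 1 ≤ ‖y‖) (hyx : y ≠ x) :
    Real.log (‖x‖ * ‖y‖ / ‖x - y‖) ≤ 2 * Real.log (min ‖x‖ ‖y‖) + ‖x - y‖⁻¹ := by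
  have h2 : 0 < ‖x - y‖ := norm_pos_iff.2 (sub_ne_zero.2 hyx.symm)
  set t := ‖x - y‖
  set m := min ‖x‖ ‖y‖ with hm
  have hm1 : 1 ≤ m := le_min hx hy
  have hmax : max ‖x‖ ‖y‖ ≤ m + t := by
    have h3 := abs_norm_sub_norm_le x y
    rw [← max_sub_min_eq_abs] at h3
    rw [hm, max_comm, min_comm]
    linarith
  have hprod : ‖x‖ * ‖y‖ = m * max ‖x‖ ‖y‖ := (min_mul_max _ _).symm
  have hle : ‖x‖ * ‖y‖ / t ≤ m ^ 2 * (1 + t⁻¹) := by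
    rw [hprod, div_le_iff₀ h2]
    have e : m ^ 2 * (1 + t⁻¹) * t = m * (m * t + m) := by field_simp
    rw [e]
    have : t ≤ m * t := le_mul_of_one_le_left h2.le hm1
    have hm0 : 0 ≤ m := by linarith
    gcongr
    linarith
  have hpos : 0 < ‖x‖ * ‖y‖ / t := by positivity
  have h4 := Real.log_le_log hpos hle
  rw [Real.log_mul (by positivity) (by positivity), Real.log_pow] at h4
  have a2 := Real.log_le_sub_one_of_pos (show 0 < 1 + t⁻¹ by positivity)
  push_cast at h4
  linarith

lemma abs_log_kernel_le_near_zero {x y : 𝔼} (hx : 3 ≤ ‖x‖) (hy : ‖y‖ ≤ 2) (hy0 : y ≠ 0) :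
    |Real.log (‖x‖ * ‖y‖ / ‖x - y‖)| ≤ 6 + ‖y‖⁻¹ := by
  have h1 : 1 ≤ ‖x - y‖ := by
    have := norm_sub_norm_le x y
    linarith
  have hy1 : 0 < ‖y‖ := norm_pos_iff.2 hy0
  have hx1 : 0 < ‖x‖ := by linarith
  have h2 : 0 < ‖x - y‖ := by linarith
  rw [mul_div_right_comm, Real.log_mul (by positivity) hy1.ne', Real.log_div hx1.ne' h2.ne']
  have h3 := abs_log_sub_log_le hx1 h2
  have h4 := abs_log_le_add_inv hy1.le
  have h5 : |‖x‖ - ‖x - y‖| ≤ 2 := by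
    have := abs_norm_sub_norm_le x (x - y)
    rw [sub_sub_cancel] at this
    linarith
  have h6 : ‖x‖⁻¹ + ‖x - y‖⁻¹ ≤ 1 + 1 := by
    gcongr
    · exact inv_le_one_of_one_le₀ (by linarith)
    · exact inv_le_one_of_one_le₀ h1
  have h7 : |‖x‖ - ‖x - y‖| * (‖x‖⁻¹ + ‖x - y‖⁻¹) ≤ 2 * (1 + 1) := by
    gcongr
  have := abs_add_le (Real.log ‖x‖ - Real.log ‖x - y‖) (Real.log ‖y‖)
  linarith

/-- Upper bound for the logarithmic potential in terms of the positive part of `f`, where `L`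
is any majorant of the slowly growing part of the kernel. -/
lemma log_potential_upper_bound (hn : 2 ≤ n) {f w : 𝔼 → ℝ} {c : ℝ} (hc : 0 < c)
    (hf : Integrable f) (hI : ∀ x, Integrable (fun y => ‖x - y‖⁻¹ * |f y|))
    (hw : ∀ x, w x = c * ∫ y, Real.log (‖y‖ / ‖x - y‖) * f y)
    {G : ℝ} (hG : ∀ᵐ y, max (f y) 0 ≤ G) {x : 𝔼} (hx : 3 ≤ ‖x‖) {L : 𝔼 → ℝ}
    (hL0 : ∀ y, 0 ≤ L y) (hL : ∀ y, 2 ≤ ‖y‖ → Real.log (min ‖x‖ ‖y‖) ≤ L y)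
    (hLg : Integrable fun y => L y * max (f y) 0) :
    w x + c * (∫ y, f y) * Real.log ‖x‖ ≤
      c * (7 * (∫ y, |f y|) + (∫ y, ‖y‖⁻¹ * |f y|) + G * invNormMass n +
        2 * ∫ y, L y * max (f y) 0) := by
  have hx0 : x ≠ 0 := norm_pos_iff.1 (by linarith)
  obtain ⟨hint, hrep⟩ := log_potential_add_log_norm hn hf hI hw hx0
  rw [hrep]
  refine mul_le_mul_of_nonneg_left ?_ hc.le
  set g : 𝔼 → ℝ := fun y => max (f y) 0 with hg
  have hgint : Integrable g := hf.pos_part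
  have hg0 : ∀ y, 0 ≤ g y := fun y => le_max_right _ _
  have hgabs : ∀ y, |g y| = g y := fun y => abs_of_nonneg (hg0 y)
  have hgf : ∀ y, g y ≤ |f y| := fun y => max_le (le_abs_self _) (abs_nonneg _)
  have hpot := inv_norm_potential_bound hn hgint x (r := 1) (M := G) one_pos (by
    filter_upwards [hG] with y hy _
    rw [hgabs]
    exact hy)
  simp only [hgabs] at hpot
  have hinv : Integrable (fun y => ‖y‖⁻¹ * |f y|) := by simpa using hI 0
  have hb1 : Integrable fun y => 6 * |f y| + ‖y‖⁻¹ * |f y| := (hf.abs.const_mul 6).add hinv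
  have hb2 : Integrable fun y => ‖x - y‖⁻¹ * g y + 2 * (L y * g y) :=
    hpot.1.add (hLg.const_mul 2)
  have hle : ∫ y, Real.log (‖x‖ * ‖y‖ / ‖x - y‖) * f y ≤
      ∫ y, ((6 * |f y| + ‖y‖⁻¹ * |f y|) + (‖x - y‖⁻¹ * g y + 2 * (L y * g y))) := by
    refine integral_mono_ae hint (hb1.add hb2) ?_
    filter_upwards [ae_ne_point hn 0, ae_ne_point hn x] with y hy hyx
    have p1 : 0 ≤ 6 * |f y| + ‖y‖⁻¹ * |f y| := by positivity
    have p2 : 0 ≤ ‖x - y‖⁻¹ * g y + 2 * (L y * g y) := by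
      have := hL0 y
      have := hg0 y
      positivity
    rcases le_or_gt ‖y‖ 2 with hy2 | hy2
    · have h1 := abs_log_kernel_le_near_zero hx hy2 hy
      have h2 := le_abs_self (Real.log (‖x‖ * ‖y‖ / ‖x - y‖) * f y)
      rw [abs_mul] at h2
      have h3 := mul_le_mul_of_nonneg_right h1 (abs_nonneg (f y))
      linarith
    · have h1 := log_kernel_nonneg (by linarith) hy2.le hyx
      have h2 := log_kernel_le (x := x) (by linarith) (by linarith) hyx
      have h3 := hL y hy2.le
      have h4 : Real.log (‖x‖ * ‖y‖ / ‖x - y‖) * f y ≤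
          Real.log (‖x‖ * ‖y‖ / ‖x - y‖) * g y :=
        mul_le_mul_of_nonneg_left (le_max_left _ _) h1
      have h5 : Real.log (‖x‖ * ‖y‖ / ‖x - y‖) * g y ≤ (2 * L y + ‖x - y‖⁻¹) * g y :=
        mul_le_mul_of_nonneg_right (by linarith) (hg0 y)
      linarith
  refine hle.trans ?_
  rw [integral_add hb1 hb2, integral_add (hf.abs.const_mul 6) hinv,
    integral_add hpot.1 (hLg.const_mul 2), integral_const_mul, integral_const_mul]
  have h6 := hpot.2
  have h7 : ∫ y, g y ≤ ∫ y, |f y| := integral_mono hgint hf.abs hgf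
  simp only [one_pow, one_mul, inv_one] at h6
  linarith

/-- Sharp upper bound `w ≤ D - a log |x|` at infinity, where `a` is the total mass. -/
lemma log_potential_decay (hn : 2 ≤ n) {f w : 𝔼 → ℝ} {c : ℝ} (hc : 0 < c)
    (hf : Integrable f) (hI : ∀ x, Integrable (fun y => ‖x - y‖⁻¹ * |f y|))
    (hw : ∀ x, w x = c * ∫ y, Real.log (‖y‖ / ‖x - y‖) * f y)
    {G P : ℝ} (hG : ∀ᵐ y, max (f y) 0 ≤ G) (hP : ∀ y, max (f y) 0 ≤ P * Real.exp (n * w y))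
    (ha : 2 ≤ c * ∫ y, f y) :
    ∃ D, ∀ x : 𝔼, 3 ≤ ‖x‖ → w x ≤ D - c * (∫ y, f y) * Real.log ‖x‖ := by
  set a := c * ∫ y, f y
  set g : 𝔼 → ℝ := fun y => max (f y) 0 with hg
  have hgint : Integrable g := hf.pos_part
  have hg0 : ∀ y, 0 ≤ g y := fun y => le_max_right _ _
  have hgf : ∀ y, g y ≤ |f y| := fun y => max_le (le_abs_self _) (abs_nonneg _)
  set Q := 7 * (∫ y, |f y|) + (∫ y, ‖y‖⁻¹ * |f y|) + G * invNormMass n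
  have hmeasN : ∀ N : ℝ, MeasurableSet {y : 𝔼 | N < ‖y‖} := fun N =>
    measurableSet_lt measurable_const measurable_norm
  have htail : Tendsto (fun N : ℕ => ∫ y in {y : 𝔼 | (N : ℝ) < ‖y‖}, g y) atTop (𝓝 0) := by
    have hanti : Antitone fun N : ℕ => {y : 𝔼 | (N : ℝ) < ‖y‖} := by
      intro N M hNM y (hy : (M : ℝ) < ‖y‖)
      exact lt_of_le_of_lt (Nat.cast_le.2 hNM) hy
    have h := tendsto_setIntegral_of_antitone (μ := volume) (f := g)
      (fun N : ℕ => hmeasN N) hanti ⟨0, hgint.integrableOn⟩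
    have hempty : ⋂ N : ℕ, {y : 𝔼 | (N : ℝ) < ‖y‖} = ∅ := by
      ext y
      simp only [mem_iInter, mem_ofPred_eq, mem_empty_iff_false, iff_false, not_forall, not_lt]
      exact exists_nat_ge ‖y‖
    rwa [hempty, setIntegral_empty] at h
  -- First pass: with little positive mass beyond radius `N`, bounding the kernel there by `log |x|`
  -- costs only `1/4` in the decay exponent.
  obtain ⟨N, hN1, hN⟩ : ∃ N : ℕ, 1 ≤ N ∧ c * (2 * ∫ y in {y : 𝔼 | (N : ℝ) < ‖y‖}, g y) < 1 / 4 := by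
    have h2 : Tendsto (fun N : ℕ => c * (2 * ∫ y in {y : 𝔼 | (N : ℝ) < ‖y‖}, g y)) atTop
        (𝓝 0) := by simpa using (htail.const_mul 2).const_mul c
    obtain ⟨N, hN⟩ := ((h2.eventually_lt_const (show (0 : ℝ) < 1 / 4 by norm_num)).and
      (eventually_ge_atTop 1)).exists
    exact ⟨N, hN.2, hN.1⟩
  have hlogN : 0 ≤ Real.log N := Real.log_nonneg (by exact_mod_cast hN1)
  have hfirst : ∀ x : 𝔼, 3 ≤ ‖x‖ →
      w x ≤ c * (Q + 2 * (Real.log N * ∫ y, g y)) - (a - 1 / 4) * Real.log ‖x‖ := by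
    intro x hx
    have hlx : 0 ≤ Real.log ‖x‖ := Real.log_nonneg (by linarith)
    have hi1 : Integrable (({y : 𝔼 | (N : ℝ) < ‖y‖}).indicator fun y => Real.log ‖x‖ * g y) :=
      (hgint.const_mul _).indicator (hmeasN N)
    have hfun : (fun y => (Real.log N + ({y : 𝔼 | (N : ℝ) < ‖y‖}).indicator
        (fun _ => Real.log ‖x‖) y) * g y) = fun y => Real.log N * g y +
        ({y : 𝔼 | (N : ℝ) < ‖y‖}).indicator (fun y => Real.log ‖x‖ * g y) y := by
      ext y
      by_cases hy : y ∈ {y : 𝔼 | (N : ℝ) < ‖y‖}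
      · rw [indicator_of_mem hy, indicator_of_mem hy, add_mul]
      · rw [indicator_of_notMem hy, indicator_of_notMem hy, add_zero, add_zero]
    have h := log_potential_upper_bound hn hc hf hI hw hG hx
      (L := fun y => Real.log N + ({y : 𝔼 | (N : ℝ) < ‖y‖}).indicator (fun _ => Real.log ‖x‖) y)
      (fun y => add_nonneg hlogN (indicator_nonneg (fun _ _ => hlx) y))
      (fun y hy => by
        by_cases hyN : y ∈ {y : 𝔼 | (N : ℝ) < ‖y‖}
        · rw [indicator_of_mem hyN]
          have := Real.log_le_log (lt_min (by linarith) (by linarith)) (min_le_left ‖x‖ ‖y‖)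
          linarith
        · rw [indicator_of_notMem hyN, add_zero]
          refine Real.log_le_log (lt_min (by linarith) (by linarith)) ?_
          exact (min_le_right _ _).trans (not_lt.1 hyN))
      (by
        change Integrable fun y => (_ + _) * g y
        rw [hfun]
        exact (hgint.const_mul _).add hi1)
    change _ ≤ c * (Q + 2 * ∫ y, (_ + _) * g y) at h
    rw [hfun, integral_add (hgint.const_mul _) hi1, integral_indicator (hmeasN N),
      integral_const_mul, integral_const_mul] at h
    have h2 := mul_le_mul_of_nonneg_right hN.le hlx
    linarith
  set D₁ := c * (Q + 2 * (Real.log N * ∫ y, g y))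
  -- Bootstrap: since `a ≥ 2` and `n ≥ 2`, `n(a - 1/4) ≥ 7n/4 ≥ n + 3/2`. Hence `|y| g(y) =
  -- O(|y|^{-(n + 1/2)})`, which is integrable at infinity.
  have hyg : Integrable fun y => ‖y‖ * g y := by
    have hdec : Integrable fun y : 𝔼 => (1 + ‖y‖) ^ (-((n : ℝ) + 1 / 2)) := by
      refine integrable_one_add_norm ?_
      rw [finrank_euclideanSpace_fin]
      linarith
    have hdom := (hf.abs.const_mul 3).add (hdec.const_mul
      (|P| * Real.exp (n * D₁) * 2 ^ ((n : ℝ) + 1 / 2)))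
    refine hdom.mono' (measurable_norm.aestronglyMeasurable.mul hgint.aestronglyMeasurable)
      (Eventually.of_forall fun y => ?_)
    rw [Real.norm_of_nonneg (mul_nonneg (norm_nonneg _) (hg0 y))]
    simp only [Pi.add_apply]
    have p2 : 0 ≤ |P| * Real.exp (n * D₁) * 2 ^ ((n : ℝ) + 1 / 2) *
        (1 + ‖y‖) ^ (-((n : ℝ) + 1 / 2)) := by positivity
    rcases le_or_gt ‖y‖ 3 with hy | hy
    · have : ‖y‖ * g y ≤ 3 * |f y| := mul_le_mul hy (hgf y) (hg0 y) (by norm_num)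
      linarith
    · have hy0 : 0 < ‖y‖ := by linarith
      have hly : 0 ≤ Real.log ‖y‖ := Real.log_nonneg (by linarith)
      have hn2 : (2 : ℝ) ≤ n := by exact_mod_cast hn
      have h1 : Real.exp (n * w y) ≤
          Real.exp (n * D₁) * ‖y‖ ^ (-((n : ℝ) + 3 / 2)) := by
        rw [Real.rpow_def_of_pos hy0, ← Real.exp_add]
        apply Real.exp_le_exp.2
        have h2 := mul_le_mul_of_nonneg_left (hfirst y hy.le) (Nat.cast_nonneg (α := ℝ) n)
        have h3 : ((n : ℝ) + 3 / 2) * Real.log ‖y‖ ≤ n * (a - 1 / 4) * Real.log ‖y‖ := by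
          refine mul_le_mul_of_nonneg_right ?_ hly
          nlinarith
        linarith
      have h4 : ‖y‖ * ‖y‖ ^ (-((n : ℝ) + 3 / 2)) = ‖y‖ ^ (-((n : ℝ) + 1 / 2)) := by
        rw [← Real.rpow_one_add' hy0.le (by linarith)]
        congr 1
        ring
      have h5 : ‖y‖ ^ (-((n : ℝ) + 1 / 2)) ≤
          2 ^ ((n : ℝ) + 1 / 2) * (1 + ‖y‖) ^ (-((n : ℝ) + 1 / 2)) := by
        have e1 : (2 : ℝ) ^ ((n : ℝ) + 1 / 2) * (1 + ‖y‖) ^ (-((n : ℝ) + 1 / 2)) =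
            ((1 + ‖y‖) / 2) ^ (-((n : ℝ) + 1 / 2)) := by
          rw [Real.div_rpow (by positivity) (by norm_num), Real.rpow_neg (show (0 : ℝ) ≤ 2 by
            norm_num), div_inv_eq_mul, mul_comm]
        rw [e1]
        exact Real.rpow_le_rpow_of_nonpos (by positivity) (by linarith) (by linarith)
      have h6 : 0 ≤ 3 * |f y| := by positivity
      calc ‖y‖ * g y ≤ ‖y‖ * (|P| * (Real.exp (n * D₁) * ‖y‖ ^ (-((n : ℝ) + 3 / 2)))) := by
            gcongr
            refine (hP y).trans ?_
            gcongr
            exact le_abs_self P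
        _ = |P| * Real.exp (n * D₁) * ‖y‖ ^ (-((n : ℝ) + 1 / 2)) := by rw [← h4]; ring
        _ ≤ |P| * Real.exp (n * D₁) *
            (2 ^ ((n : ℝ) + 1 / 2) * (1 + ‖y‖) ^ (-((n : ℝ) + 1 / 2))) := by gcongr
        _ ≤ _ := by linarith
  -- Second pass: the majorant `L y = |y|` no longer depends on `x`, so the lost `1/4` is recovered.
  refine ⟨c * (Q + 2 * ∫ y, ‖y‖ * g y), fun x hx => ?_⟩
  have h := log_potential_upper_bound hn hc hf hI hw hG hx (L := fun y => ‖y‖)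
    (fun y => norm_nonneg y) (fun y hy => by
      have h1 := Real.log_le_log (lt_min (by linarith) (by linarith)) (min_le_right ‖x‖ ‖y‖)
      have h2 := Real.log_le_sub_one_of_pos (show 0 < ‖y‖ by linarith)
      linarith) hyg
  change _ ≤ c * (Q + 2 * ∫ y, ‖y‖ * g y) at h
  linarith

/-! ### The smoothed potential and its radial derivative. -/

/-- The logarithmic potential with the kernel smoothed at scale `ε`. -/
noncomputable def smoothedPotential (f : EuclideanSpace ℝ (Fin n) → ℝ) (c ε : ℝ)
    (x : EuclideanSpace ℝ (Fin n)) : ℝ :=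
  c * ∫ y, (Real.log ‖y‖ - 1 / 2 * Real.log (‖x - y‖ ^ 2 + ε ^ 2)) * f y

/-- The integral which is, up to the factor `-c`, the radial derivative of the smoothed
potential; `x` is the direction and `z` the base point. -/
noncomputable def smoothedGradient (f : EuclideanSpace ℝ (Fin n) → ℝ) (ε : ℝ)
    (x z : EuclideanSpace ℝ (Fin n)) : ℝ :=
  ∫ y, inner ℝ x (z - y) / (‖z - y‖ ^ 2 + ε ^ 2) * f y

lemma abs_smoothed_kernel_sub_le {ε : ℝ} (hε : 0 < ε) {x y : 𝔼} (hy : y ≠ 0) (hyx : y ≠ x) :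
    |(Real.log ‖y‖ - 1 / 2 * Real.log (‖x - y‖ ^ 2 + ε ^ 2)) - Real.log (‖y‖ / ‖x - y‖)| ≤
      ε * ‖x - y‖⁻¹ := by
  have h1 : 0 < ‖y‖ := norm_pos_iff.2 hy
  have h2 : 0 < ‖x - y‖ := norm_pos_iff.2 (sub_ne_zero.2 hyx.symm)
  set t := ‖x - y‖
  rw [Real.log_div h1.ne' h2.ne']
  have e1 : 2 * Real.log t ≤ Real.log (t ^ 2 + ε ^ 2) := by
    have : Real.log (t ^ 2) ≤ Real.log (t ^ 2 + ε ^ 2) :=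
      Real.log_le_log (by positivity) (by nlinarith)
    rw [Real.log_pow] at this
    exact_mod_cast this
  have e2 : Real.log (t ^ 2 + ε ^ 2) ≤ 2 * Real.log t + 2 * (ε * t⁻¹) := by
    have h3 : t ^ 2 + ε ^ 2 ≤ (t * (1 + ε * t⁻¹)) ^ 2 := by
      have : t * (1 + ε * t⁻¹) = t + ε := by field_simp
      rw [this]
      nlinarith [mul_pos h2 hε]
    have h4 := Real.log_le_log (by positivity) h3
    rw [Real.log_pow, Real.log_mul h2.ne' (by positivity)] at h4
    have := Real.log_le_sub_one_of_pos (show 0 < 1 + ε * t⁻¹ by positivity)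
    push_cast at h4
    linarith
  have : 0 < ε * t⁻¹ := by positivity
  rw [abs_le]
  constructor <;> linarith

lemma integrable_smoothed_kernel (hn : 2 ≤ n) {f : 𝔼 → ℝ}
    (hf : Integrable f) (hI : ∀ x, Integrable (fun y => ‖x - y‖⁻¹ * |f y|))
    {ε : ℝ} (hε : 0 < ε) (x : 𝔼) :
    Integrable fun y => (Real.log ‖y‖ - 1 / 2 * Real.log (‖x - y‖ ^ 2 + ε ^ 2)) * f y := by
  have h1 := integrable_log_kernel hn hf hI x
  refine ((h1.abs).add ((hI x).const_mul ε)).mono' ?_ ?_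
  · exact (Measurable.aestronglyMeasurable (by fun_prop)).mul hf.aestronglyMeasurable
  · filter_upwards [ae_ne_point hn 0, ae_ne_point hn x] with y hy hyx
    have h2 := mul_le_mul_of_nonneg_right (abs_smoothed_kernel_sub_le hε hy hyx)
      (abs_nonneg (f y))
    rw [← abs_mul, sub_mul] at h2
    have h3 := abs_sub_abs_le_abs_sub
      ((Real.log ‖y‖ - 1 / 2 * Real.log (‖x - y‖ ^ 2 + ε ^ 2)) * f y)
      (Real.log (‖y‖ / ‖x - y‖) * f y)
    rw [Real.norm_eq_abs]
    simp only [Pi.add_apply]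
    linarith

lemma abs_smoothedPotential_sub_le (hn : 2 ≤ n) {f w : 𝔼 → ℝ} {c κ : ℝ} (hc : 0 < c)
    (hf : Integrable f) (hI : ∀ x, Integrable (fun y => ‖x - y‖⁻¹ * |f y|))
    (hw : ∀ x, w x = c * ∫ y, Real.log (‖y‖ / ‖x - y‖) * f y)
    (hκ : ∀ x, ∫ y, ‖x - y‖⁻¹ * |f y| ≤ κ) {ε : ℝ} (hε : 0 < ε) (x : 𝔼) :
    |smoothedPotential f c ε x - w x| ≤ c * κ * ε := by
  rw [smoothedPotential, hw, ← mul_sub, ← integral_sub (integrable_smoothed_kernel hn hf hI hε x)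
    (integrable_log_kernel hn hf hI x), abs_mul, abs_of_pos hc, mul_assoc]
  gcongr
  have hb : ∀ᵐ y, ‖(Real.log ‖y‖ - 1 / 2 * Real.log (‖x - y‖ ^ 2 + ε ^ 2)) * f y -
      Real.log (‖y‖ / ‖x - y‖) * f y‖ ≤ ε * (‖x - y‖⁻¹ * |f y|) := by
    filter_upwards [ae_ne_point hn 0, ae_ne_point hn x] with y hy hyx
    rw [← sub_mul, norm_mul, Real.norm_eq_abs, Real.norm_eq_abs, ← mul_assoc]
    exact mul_le_mul_of_nonneg_right (abs_smoothed_kernel_sub_le hε hy hyx) (abs_nonneg _)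
  have h := norm_integral_le_of_norm_le ((hI x).const_mul ε) hb
  rw [integral_const_mul, Real.norm_eq_abs] at h
  refine h.trans ?_
  rw [mul_comm κ]
  exact mul_le_mul_of_nonneg_left (hκ x) hε.le

/-- The first bound is uniform in `ε` and survives the limit; the second is uniform in `v` and
justifies differentiating under the integral for fixed `ε`. -/
lemma abs_inner_div_le (x v : 𝔼) {ε : ℝ} (hε : 0 < ε) :
    |inner ℝ x v / (‖v‖ ^ 2 + ε ^ 2)| ≤ ‖x‖ * ‖v‖⁻¹ ∧
    |inner ℝ x v / (‖v‖ ^ 2 + ε ^ 2)| ≤ ‖x‖ * ε⁻¹ := by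
  have h1 := abs_real_inner_le_norm x v
  have h0 : 0 < ‖v‖ ^ 2 + ε ^ 2 := by positivity
  rw [abs_div, abs_of_pos h0]
  constructor
  · rcases eq_or_ne v 0 with rfl | hv
    · simp
    have hv0 := norm_pos_iff.2 hv
    rw [div_le_iff₀ h0]
    refine h1.trans ?_
    rw [mul_assoc]
    gcongr
    rw [← div_eq_inv_mul, le_div_iff₀ hv0]
    nlinarith
  · rw [div_le_iff₀ h0]
    refine h1.trans ?_
    rw [mul_assoc]
    gcongr
    rw [← div_eq_inv_mul, le_div_iff₀ hε]
    nlinarith [sq_nonneg (‖v‖ - ε)]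

lemma integrable_smoothedGradient {f : 𝔼 → ℝ} (hf : Integrable f) {ε : ℝ} (hε : 0 < ε)
    (x z : 𝔼) :
    Integrable fun y => inner ℝ x (z - y) / (‖z - y‖ ^ 2 + ε ^ 2) * f y := by
  refine (hf.abs.const_mul (‖x‖ * ε⁻¹)).mono' ?_ (Eventually.of_forall fun y => ?_)
  · exact (Measurable.aestronglyMeasurable (by fun_prop)).mul hf.aestronglyMeasurable
  · rw [norm_mul, Real.norm_eq_abs, Real.norm_eq_abs]
    exact mul_le_mul_of_nonneg_right (abs_inner_div_le x _ hε).2 (abs_nonneg _)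

lemma abs_smoothedGradient_le {f : 𝔼 → ℝ}
    (hI : ∀ x, Integrable (fun y => ‖x - y‖⁻¹ * |f y|)) {ε : ℝ} (hε : 0 < ε) (x z : 𝔼) :
    |smoothedGradient f ε x z| ≤ ‖x‖ * ∫ y, ‖z - y‖⁻¹ * |f y| := by
  rw [← integral_const_mul, smoothedGradient, ← Real.norm_eq_abs]
  refine norm_integral_le_of_norm_le ((hI z).const_mul ‖x‖) (Eventually.of_forall fun y => ?_)
  rw [norm_mul, Real.norm_eq_abs, Real.norm_eq_abs, ← mul_assoc]
  exact mul_le_mul_of_nonneg_right (abs_inner_div_le x _ hε).1 (abs_nonneg _)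

lemma hasDerivAt_smoothedPotential (hn : 2 ≤ n) {f : 𝔼 → ℝ} {c : ℝ}
    (hf : Integrable f) (hI : ∀ x, Integrable (fun y => ‖x - y‖⁻¹ * |f y|))
    {ε : ℝ} (hε : 0 < ε) (x : 𝔼) (l : ℝ) :
    HasDerivAt (fun l : ℝ => smoothedPotential f c ε (l • x))
      (-c * smoothedGradient f ε x (l • x)) l := by
  have hd : ∀ (y : 𝔼) (s : ℝ), HasDerivAt
      (fun s : ℝ => (Real.log ‖y‖ - 1 / 2 * Real.log (‖s • x - y‖ ^ 2 + ε ^ 2)) * f y)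
      (-(inner ℝ x (s • x - y) / (‖s • x - y‖ ^ 2 + ε ^ 2) * f y)) s := by
    intro y s
    have h0 : HasDerivAt (fun s : ℝ => s • x - y) x s := by
      simpa using ((hasDerivAt_id s).smul_const x).sub_const y
    have h1 := (h0.norm_sq.add_const (ε ^ 2)).log (by positivity)
    have h2 := ((h1.const_mul (1 / 2)).const_sub (Real.log ‖y‖)).mul_const (f y)
    refine h2.congr_deriv ?_
    rw [real_inner_comm]
    ring
  have h := (hasDerivAt_integral_of_dominated_loc_of_deriv_le (μ := volume) (s := univ)
    (x₀ := l) (bound := fun y => ‖x‖ * ε⁻¹ * |f y|)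
    (F := fun s y => (Real.log ‖y‖ - 1 / 2 * Real.log (‖s • x - y‖ ^ 2 + ε ^ 2)) * f y)
    (F' := fun s y => -(inner ℝ x (s • x - y) / (‖s • x - y‖ ^ 2 + ε ^ 2) * f y))
    univ_mem
    (Eventually.of_forall fun s => (integrable_smoothed_kernel hn hf hI hε (s • x)).1)
    (integrable_smoothed_kernel hn hf hI hε (l • x))
    (integrable_smoothedGradient hf hε x (l • x)).neg.1
    (Eventually.of_forall fun y s _ => by
      rw [norm_neg, norm_mul, Real.norm_eq_abs, Real.norm_eq_abs]
      exact mul_le_mul_of_nonneg_right (abs_inner_div_le x _ hε).2 (abs_nonneg _))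
    (hf.abs.const_mul _)
    (Eventually.of_forall fun y s _ => hd y s)).2
  have h2 := h.const_mul c
  refine h2.congr_deriv ?_
  rw [integral_neg, smoothedGradient]
  ring

/-- The `1/|x|` decay encoded in `hM` exactly offsets the factor `|x|` of the radial derivative, so
the bound is uniform in `x` and `ε`. -/
lemma abs_deriv_smoothedPotential_le {f : 𝔼 → ℝ} {M : ℝ}
    (hI : ∀ x, Integrable (fun y => ‖x - y‖⁻¹ * |f y|))
    (hM : ∀ x : 𝔼, ‖x‖ * ∫ y, ‖x - y‖⁻¹ * |f y| ≤ M)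
    {ε : ℝ} (hε : 0 < ε) (x : 𝔼) {l : ℝ} (hl : 1 / 2 < l) :
    |smoothedGradient f ε x (l • x)| ≤ 2 * M := by
  have h1 := abs_smoothedGradient_le hI hε x (l • x)
  have h2 := hM (l • x)
  rw [norm_smul, Real.norm_of_nonneg (by linarith), mul_assoc] at h2
  have h3 : 0 ≤ ‖x‖ * ∫ y, ‖l • x - y‖⁻¹ * |f y| :=
    mul_nonneg (norm_nonneg _) (integral_nonneg fun _ => by positivity)
  nlinarith

lemma aestronglyMeasurable_smoothedPotential {f : 𝔼 → ℝ} (hf : Integrable f) (c ε l : ℝ) :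
    AEStronglyMeasurable (fun x : 𝔼 => smoothedPotential f c ε (l • x)) volume := by
  have h : AEStronglyMeasurable (fun p : 𝔼 × 𝔼 =>
      (Real.log ‖p.2‖ - 1 / 2 * Real.log (‖l • p.1 - p.2‖ ^ 2 + ε ^ 2)) * f p.2)
      (volume.prod volume) :=
    (Measurable.aestronglyMeasurable (by fun_prop)).mul hf.aestronglyMeasurable.comp_snd
  exact h.integral_prod_right'.const_mul c

lemma aestronglyMeasurable_smoothedGradient {f : 𝔼 → ℝ} (hf : Integrable f) (ε : ℝ) :
    AEStronglyMeasurable (fun x : 𝔼 => smoothedGradient f ε x x) volume := by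
  have h : AEStronglyMeasurable (fun p : 𝔼 × 𝔼 =>
      inner ℝ p.1 (p.1 - p.2) / (‖p.1 - p.2‖ ^ 2 + ε ^ 2) * f p.2)
      (volume.prod volume) :=
    (Measurable.aestronglyMeasurable (by fun_prop)).mul hf.aestronglyMeasurable.comp_snd
  exact h.integral_prod_right'

/-- Symmetrization of the double integral of the radial derivative. -/
lemma integral_mul_smoothedGradient {f : 𝔼 → ℝ} {M : ℝ} (hf : Integrable f)
    (hI : ∀ x, Integrable (fun y => ‖x - y‖⁻¹ * |f y|))
    (hM : ∀ x : 𝔼, ‖x‖ * ∫ y, ‖x - y‖⁻¹ * |f y| ≤ M) {ε : ℝ} (hε : 0 < ε) :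
    ∫ x, f x * smoothedGradient f ε x x =
      1 / 2 * ∫ p : 𝔼 × 𝔼, ‖p.1 - p.2‖ ^ 2 / (‖p.1 - p.2‖ ^ 2 + ε ^ 2) * (f p.1 * f p.2) := by
  set F : 𝔼 × 𝔼 → ℝ := fun p =>
    f p.1 * (inner ℝ p.1 (p.1 - p.2) / (‖p.1 - p.2‖ ^ 2 + ε ^ 2) * f p.2) with hF
  have hmeas : AEStronglyMeasurable F (volume.prod volume) :=
    hf.aestronglyMeasurable.comp_fst.mul
      ((Measurable.aestronglyMeasurable (by fun_prop)).mul hf.aestronglyMeasurable.comp_snd)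
  have hint : Integrable F (volume.prod volume) := by
    rw [integrable_prod_iff hmeas]
    constructor
    · exact Eventually.of_forall fun x => (integrable_smoothedGradient hf hε x x).const_mul (f x)
    · refine (hf.abs.const_mul M).mono' hmeas.norm.integral_prod_right'
        (Eventually.of_forall fun x => ?_)
      rw [Real.norm_of_nonneg (integral_nonneg fun _ => norm_nonneg _)]
      simp only [hF, norm_mul (f x), integral_const_mul, Real.norm_eq_abs]
      rw [mul_comm]
      refine mul_le_mul_of_nonneg_right ?_ (abs_nonneg _)
      refine le_trans ?_ (hM x)
      rw [← integral_const_mul]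
      refine integral_mono (integrable_smoothedGradient hf hε x x).abs
        ((hI x).const_mul ‖x‖) fun y => ?_
      simp only [abs_mul, ← mul_assoc]
      exact mul_le_mul_of_nonneg_right (abs_inner_div_le x _ hε).1 (abs_nonneg _)
  have h1 : ∫ x, f x * smoothedGradient f ε x x = ∫ p, F p ∂(volume.prod volume) := by
    rw [integral_prod _ hint]
    simp only [hF, integral_const_mul, smoothedGradient]
  have h2 : ∫ p, F p ∂(volume.prod volume) = ∫ p, F p.swap ∂(volume.prod volume) :=
    (integral_prod_swap F).symm
  have h3 : ∫ p, F p ∂(volume.prod volume) + ∫ p, F p.swap ∂(volume.prod volume) =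
      ∫ p : 𝔼 × 𝔼, ‖p.1 - p.2‖ ^ 2 / (‖p.1 - p.2‖ ^ 2 + ε ^ 2) * (f p.1 * f p.2) := by
    have hswap : Integrable (fun p : 𝔼 × 𝔼 => F p.swap) (volume.prod volume) := hint.swap
    rw [← integral_add hint hswap]
    refine integral_congr_ae (Eventually.of_forall fun p => ?_)
    obtain ⟨x, y⟩ := p
    simp only [hF, Prod.swap_prod_mk]
    rw [norm_sub_rev y x]
    -- This identity cancels the singularity of the kernel and is the source of the factor `1/2` in
    -- the Pohozaev inequality.
    have : inner ℝ x (x - y) + inner ℝ y (y - x) = ‖x - y‖ ^ 2 := by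
      rw [← real_inner_self_eq_norm_sq, inner_sub_left x y (x - y), ← neg_sub x y, inner_neg_right]
      ring
    rw [← this]
    ring
  rw [h1]
  linarith

/-- After symmetrization the kernel lies in `[0, 1]` and tends to 1 off the diagonal, which is a
null set; `|f(x) f(y)|` dominates. -/
lemma tendsto_integral_mul_smoothedGradient (hn : 2 ≤ n) {f : 𝔼 → ℝ} {M : ℝ} (hf : Integrable f)
    (hI : ∀ x, Integrable (fun y => ‖x - y‖⁻¹ * |f y|))
    (hM : ∀ x : 𝔼, ‖x‖ * ∫ y, ‖x - y‖⁻¹ * |f y| ≤ M) :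
    Tendsto (fun ε => ∫ x, f x * smoothedGradient f ε x x) (𝓝[>] 0)
      (𝓝 (1 / 2 * (∫ x, f x) ^ 2)) := by
  have hff : Integrable (fun p : 𝔼 × 𝔼 => f p.1 * f p.2) (volume.prod volume) := hf.mul_prod hf
  have hdiag : ∀ᵐ p : 𝔼 × 𝔼 ∂(volume.prod volume), p.2 ≠ p.1 := by
    have hms : MeasurableSet {p : 𝔼 × 𝔼 | p.2 ≠ p.1} :=
      (measurableSet_eq_fun measurable_snd measurable_fst).compl
    rw [Measure.ae_prod_iff_ae_ae hms]
    exact Eventually.of_forall fun x => ae_ne_point hn x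
  have hlim : Tendsto (fun ε : ℝ => ∫ p : 𝔼 × 𝔼,
      ‖p.1 - p.2‖ ^ 2 / (‖p.1 - p.2‖ ^ 2 + ε ^ 2) * (f p.1 * f p.2) ∂(volume.prod volume))
      (𝓝[>] 0) (𝓝 (∫ p : 𝔼 × 𝔼, f p.1 * f p.2 ∂(volume.prod volume))) := by
    refine tendsto_integral_filter_of_dominated_convergence
      (fun p => |f p.1 * f p.2|) ?_ ?_ hff.abs ?_
    · exact Eventually.of_forall fun ε =>
        (Measurable.aestronglyMeasurable (by fun_prop)).mul hff.aestronglyMeasurable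
    · refine Eventually.of_forall fun ε => Eventually.of_forall fun p => ?_
      rw [norm_mul, Real.norm_eq_abs (f p.1 * f p.2), Real.norm_of_nonneg (by positivity)]
      refine mul_le_of_le_one_left (abs_nonneg _) ?_
      exact div_le_one_of_le₀ (by nlinarith [sq_nonneg ε]) (by positivity)
    · filter_upwards [hdiag] with p hp
      have h2 : 0 < ‖p.1 - p.2‖ := norm_pos_iff.2 (sub_ne_zero.2 hp.symm)
      have hcont : ContinuousAt (fun ε : ℝ =>
          ‖p.1 - p.2‖ ^ 2 / (‖p.1 - p.2‖ ^ 2 + ε ^ 2) * (f p.1 * f p.2)) 0 := by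
        refine ContinuousAt.mul (ContinuousAt.div (by fun_prop) (by fun_prop) ?_) (by fun_prop)
        positivity
      have h3 := hcont.tendsto
      have h4 : ‖p.1 - p.2‖ ^ 2 / (‖p.1 - p.2‖ ^ 2 + (0 : ℝ) ^ 2) * (f p.1 * f p.2) =
          f p.1 * f p.2 := by
        rw [zero_pow two_ne_zero, add_zero, div_self (by positivity), one_mul]
      rw [h4] at h3
      exact h3.mono_left nhdsWithin_le_nhds
  have heq : ∫ p : 𝔼 × 𝔼, f p.1 * f p.2 ∂(volume.prod volume) = (∫ x, f x) ^ 2 := by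
    rw [integral_prod_mul, sq]
  rw [heq] at hlim
  refine (hlim.const_mul (1 / 2)).congr' ?_
  filter_upwards [self_mem_nhdsWithin] with ε hε
  exact (integral_mul_smoothedGradient hf hI hM hε).symm

/-! ### The Pohozaev inequality by dilation. -/

lemma hasDerivAt_nonneg_of_right {φ : ℝ → ℝ} {d a δ : ℝ} (h : HasDerivAt φ d a) (h0 : φ a = 0)
    (hδ : 0 < δ) (hpos : ∀ l, a < l → l < a + δ → 0 ≤ φ l) : 0 ≤ d := by
  have h1 := (hasDerivAt_iff_tendsto_slope.1 h).mono_left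
    (nhdsWithin_mono a (show Ioi a ⊆ {a}ᶜ from fun l hl => ne_of_gt hl))
  refine ge_of_tendsto h1 ?_
  filter_upwards [Ioo_mem_nhdsGT (show a < a + δ by linarith)] with l hl
  rw [slope_def_field, h0, sub_zero]
  exact div_nonneg (hpos l hl.1 hl.2) (by linarith [hl.1])

lemma abs_smoothedPotential_smul_sub_le (hn : 2 ≤ n) {f : 𝔼 → ℝ} {c M : ℝ} (hc : 0 < c)
    (hf : Integrable f) (hI : ∀ x, Integrable (fun y => ‖x - y‖⁻¹ * |f y|))
    (hM : ∀ x : 𝔼, ‖x‖ * ∫ y, ‖x - y‖⁻¹ * |f y| ≤ M) {ε : ℝ} (hε : 0 < ε) (x : 𝔼) {l : ℝ}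
    (hl : l ∈ Ioo (1 / 2 : ℝ) (3 / 2)) :
    |smoothedPotential f c ε (l • x) - smoothedPotential f c ε x| ≤ c * M := by
  have h := (convex_Ioo (1 / 2 : ℝ) (3 / 2)).norm_image_sub_le_of_norm_hasDerivWithin_le
    (C := c * (2 * M)) (x := 1) (y := l)
    (fun s _ => (hasDerivAt_smoothedPotential (c := c) hn hf hI hε x s).hasDerivWithinAt)
    (fun s hs => by
      rw [norm_mul, norm_neg, Real.norm_of_nonneg hc.le]
      exact mul_le_mul_of_nonneg_left (abs_deriv_smoothedPotential_le hI hM hε x hs.1) hc.le)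
    (by constructor <;> norm_num) hl
  rw [one_smul] at h
  have hM0 : 0 ≤ M := by simpa using hM 0
  have h2 : ‖l - 1‖ ≤ 1 / 2 := by
    rw [Real.norm_eq_abs, abs_le]
    constructor <;> linarith [hl.1, hl.2]
  have h3 : 0 ≤ c * (2 * M) := by positivity
  refine h.trans ((mul_le_mul_of_nonneg_left h2 h3).trans_eq (by ring))

/-- Pohozaev-type inequality for the smoothed potential, obtained by differentiating
`l ↦ ∫ K(x) e^{n w_ε(l x)} dx` at `l = 1`. -/
lemma smoothed_pohozaev (hn : 2 ≤ n) {f w K : 𝔼 → ℝ} {c κ M : ℝ} (hc : 0 < c)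
    (hf : Integrable f) (hI : ∀ x, Integrable (fun y => ‖x - y‖⁻¹ * |f y|))
    (hw : ∀ x, w x = c * ∫ y, Real.log (‖y‖ / ‖x - y‖) * f y)
    (hκ : ∀ x, ∫ y, ‖x - y‖⁻¹ * |f y| ≤ κ)
    (hM : ∀ x : 𝔼, ‖x‖ * ∫ y, ‖x - y‖⁻¹ * |f y| ≤ M)
    (hK : Continuous K) (hfK : ∀ x, f x = K x * Real.exp (n * w x))
    (hmono : ∀ (x : 𝔼) (l : ℝ), 1 ≤ l → K x ≤ K (l⁻¹ • x))
    {x₀ : 𝔼} {r η δ : ℝ} (hδ : 0 < δ)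
    (hstrict : ∀ x ∈ ball x₀ r, ∀ l : ℝ, 1 < l → l < 1 + δ →
      (1 - l⁻¹) * η ≤ K (l⁻¹ • x) - K x)
    (hB : IntegrableOn (fun x => Real.exp (n * w x)) (ball x₀ r)) {ε : ℝ} (hε : 0 < ε) :
    n * c * ∫ x, K x * Real.exp (n * smoothedPotential f c ε x) * smoothedGradient f ε x x ≤
      n * (∫ x, K x * Real.exp (n * smoothedPotential f c ε x)) -
        η * ∫ x in ball x₀ r, Real.exp (n * smoothedPotential f c ε x) := by
  set W := smoothedPotential f c ε with hW
  set B := ball x₀ r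
  have hWsub := abs_smoothedPotential_sub_le hn hc hf hI hw hκ hε
  have hM0 : 0 ≤ M := by simpa using hM 0
  have hWmeas : ∀ l : ℝ, AEStronglyMeasurable (fun x : 𝔼 => Real.exp (n * W (l • x))) volume :=
    fun l => Real.continuous_exp.comp_aestronglyMeasurable
      ((aestronglyMeasurable_smoothedPotential hf c ε l).const_mul _)
  have hKWmeas : ∀ l : ℝ, AEStronglyMeasurable
      (fun x : 𝔼 => K x * Real.exp (n * W (l • x))) volume :=
    fun l => hK.aestronglyMeasurable.mul (hWmeas l)
  set q := Real.exp (n * (c * M + c * κ * ε)) with hq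
  have hexp : ∀ (x : 𝔼) (l : ℝ), l ∈ Ioo (1 / 2 : ℝ) (3 / 2) →
      Real.exp (n * W (l • x)) ≤ q * Real.exp (n * w x) := by
    intro x l hl
    rw [hq, ← Real.exp_add, ← mul_add]
    apply Real.exp_le_exp.2
    have h1 := le_of_abs_le (abs_smoothedPotential_smul_sub_le hn hc hf hI hM hε x hl)
    have h2 := le_of_abs_le (hWsub x)
    refine mul_le_mul_of_nonneg_left ?_ (Nat.cast_nonneg n)
    linarith
  have hexp1 : ∀ x, Real.exp (n * W x) ≤ q * Real.exp (n * w x) := by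
    intro x
    simpa using hexp x 1 (by constructor <;> norm_num)
  have hKbound : ∀ (x : 𝔼) (l : ℝ), l ∈ Ioo (1 / 2 : ℝ) (3 / 2) →
      |K x * Real.exp (n * W (l • x))| ≤ q * |f x| := by
    intro x l hl
    rw [hfK, abs_mul, abs_mul, Real.abs_exp, Real.abs_exp]
    have := mul_le_mul_of_nonneg_left (hexp x l hl) (abs_nonneg (K x))
    linarith
  have hKint : ∀ l : ℝ, l ∈ Ioo (1 / 2 : ℝ) (3 / 2) →
      Integrable (fun x : 𝔼 => K x * Real.exp (n * W (l • x))) := fun l hl =>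
    (hf.abs.const_mul q).mono' (hKWmeas l) (Eventually.of_forall fun x => hKbound x l hl)
  have hone : (1 : ℝ) ∈ Ioo (1 / 2 : ℝ) (3 / 2) := by constructor <;> norm_num
  have hKint1 : Integrable (fun x : 𝔼 => K x * Real.exp (n * W x)) := by
    simpa using hKint 1 hone
  have hBint : IntegrableOn (fun x => Real.exp (n * W x)) B := by
    refine Integrable.mono' (hB.const_mul q) ?_ (Eventually.of_forall fun x => ?_)
    · simpa using (hWmeas 1).restrict
    · rw [Real.norm_of_nonneg (Real.exp_pos _).le]
      exact hexp1 x
  set H : ℝ → ℝ := fun l => ∫ x, K x * Real.exp (n * W (l • x)) with hH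
  set H₁ := ∫ x, K x * Real.exp (n * W x) with hH₁
  set b := ∫ x in B, Real.exp (n * W x)
  have hderiv : HasDerivAt H
      (-(n * c * ∫ x, K x * Real.exp (n * W x) * smoothedGradient f ε x x)) 1 := by
    have h := (hasDerivAt_integral_of_dominated_loc_of_deriv_le (μ := volume)
      (s := Ioo (1 / 2 : ℝ) (3 / 2)) (x₀ := 1)
      (bound := fun x => (n * (c * (2 * M)) * q) * |f x|)
      (F := fun l x => K x * Real.exp (n * W (l • x)))
      (F' := fun l x => K x * (Real.exp (n * W (l • x)) *
        (n * (-c * smoothedGradient f ε x (l • x)))))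
      (Ioo_mem_nhds hone.1 hone.2)
      (Eventually.of_forall fun l => hKWmeas l) (hKint 1 hone)
      (by
        have h1 := (hKWmeas 1).mul
          ((aestronglyMeasurable_smoothedGradient hf ε).const_mul (n * -c))
        refine h1.congr (Eventually.of_forall fun x => ?_)
        simp only [one_smul, Pi.mul_apply]
        ring)
      (Eventually.of_forall fun x l hl => by
        have h1 := hKbound x l hl
        have h2 := abs_deriv_smoothedPotential_le hI hM hε x hl.1
        rw [← mul_assoc, norm_mul, norm_mul (n : ℝ), norm_mul (-c), norm_neg,
          Real.norm_of_nonneg hc.le, Real.norm_of_nonneg (Nat.cast_nonneg n), Real.norm_eq_abs,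
          Real.norm_eq_abs]
        calc _ ≤ (q * |f x|) * (n * (c * (2 * M))) := by gcongr
          _ = _ := by ring)
      (hf.abs.const_mul _)
      (Eventually.of_forall fun x l _ =>
        (((hasDerivAt_smoothedPotential hn hf hI hε x l).const_mul (n : ℝ)).exp).const_mul _)).2
    refine h.congr_deriv ?_
    rw [← integral_const_mul, ← integral_neg]
    refine integral_congr_ae (Eventually.of_forall fun x => ?_)
    simp only [one_smul]
    ring
  -- Substituting `x ↦ l⁻¹ x` gives `H l = l^{-n} ∫ K(l⁻¹ x) e^{nW(x)} dx`. Monotonicity then bounds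
  -- the integral below by `H₁`, with a first-order gain from the ball `B`.
  have hlower : ∀ l : ℝ, 1 < l → l < 1 + min δ (1 / 2) →
      0 ≤ H l - (l ^ n)⁻¹ * (H₁ + (1 - l⁻¹) * η * b) := by
    intro l hl1 hl2
    have hlδ : l < 1 + δ := hl2.trans_le (by linarith [min_le_left δ (1 / 2)])
    have hlI : l ∈ Ioo (1 / 2 : ℝ) (3 / 2) := by
      constructor <;> linarith [min_le_right δ (1 / 2)]
    have hl0 : 0 < l := by linarith
    set G : 𝔼 → ℝ := fun x => K (l⁻¹ • x) * Real.exp (n * W x) with hG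
    have hGl : (fun x => G (l • x)) = fun x => K x * Real.exp (n * W (l • x)) := by
      ext x
      simp only [hG]
      rw [smul_smul, inv_mul_cancel₀ hl0.ne', one_smul]
    have hGint : Integrable G := by
      rw [← integrable_comp_smul_iff volume G hl0.ne', hGl]
      exact hKint l hlI
    have hHG : H l = (l ^ n)⁻¹ * ∫ x, G x := by
      have := Measure.integral_comp_smul_of_nonneg volume G l (hR := hl0.le)
      rw [finrank_euclideanSpace_fin, smul_eq_mul, hGl] at this
      exact this
    have hind : Integrable (B.indicator fun x => (1 - l⁻¹) * η * Real.exp (n * W x)) :=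
      IntegrableOn.integrable_indicator (hBint.const_mul _) measurableSet_ball
    have hge : H₁ + (1 - l⁻¹) * η * b ≤ ∫ x, G x := by
      have e : H₁ + (1 - l⁻¹) * η * b = ∫ x, (K x * Real.exp (n * W x) +
          B.indicator (fun x => (1 - l⁻¹) * η * Real.exp (n * W x)) x) := by
        rw [integral_add hKint1 hind, integral_indicator measurableSet_ball, integral_const_mul]
      rw [e]
      refine integral_mono (hKint1.add hind) hGint fun x => ?_
      simp only [hG]
      have hE : 0 ≤ Real.exp (n * W x) := (Real.exp_pos _).le
      by_cases hx : x ∈ B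
      · rw [indicator_of_mem hx]
        have := mul_le_mul_of_nonneg_right (hstrict x hx l hl1 hlδ) hE
        linarith
      · rw [indicator_of_notMem hx, add_zero]
        exact mul_le_mul_of_nonneg_right (hmono x l hl1.le) hE
    rw [hHG, ← mul_sub]
    exact mul_nonneg (by positivity) (by linarith)
  -- The difference vanishes at `l = 1` and is nonnegative just to the right, so its derivative
  -- there is nonnegative, which is the claim.
  have hφ : HasDerivAt (fun l : ℝ => H l - (l ^ n)⁻¹ * (H₁ + (1 - l⁻¹) * η * b))
      (-(n * c * ∫ x, K x * Real.exp (n * W x) * smoothedGradient f ε x x) -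
        (-(n : ℝ) * H₁ + η * b)) 1 := by
    have h1 := ((hasDerivAt_pow n (1 : ℝ)).inv (by simp)).mul
      ((((((hasDerivAt_inv (one_ne_zero (α := ℝ))).const_sub 1).mul_const η).mul_const b)).const_add
        H₁)
    refine (hderiv.sub h1).congr_deriv ?_
    simp
  have := hasDerivAt_nonneg_of_right hφ (by simp [hH, hH₁])
    (lt_min hδ (by norm_num)) hlower
  linarith

/-- Strict Pohozaev inequality for a nonincreasing `K` which is strictly decreasing along rays
somewhere: the total mass `Λ = ∫ f` satisfies `c Λ² / 2 < Λ`. -/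
theorem total_mass_lt_of_radially_decreasing (hn : 2 ≤ n) {f w K : 𝔼 → ℝ} {c κ M : ℝ} (hc : 0 < c)
    (hf : Integrable f) (hI : ∀ x, Integrable (fun y => ‖x - y‖⁻¹ * |f y|))
    (hw : ∀ x, w x = c * ∫ y, Real.log (‖y‖ / ‖x - y‖) * f y)
    (hκ : ∀ x, ∫ y, ‖x - y‖⁻¹ * |f y| ≤ κ)
    (hM : ∀ x : 𝔼, ‖x‖ * ∫ y, ‖x - y‖⁻¹ * |f y| ≤ M)
    (hK : Continuous K) (hfK : ∀ x, f x = K x * Real.exp (n * w x))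
    (hmono : ∀ (x : 𝔼) (l : ℝ), 1 ≤ l → K x ≤ K (l⁻¹ • x))
    {x₀ : 𝔼} {r η δ : ℝ} (hr : 0 < r) (hη : 0 < η) (hδ : 0 < δ)
    (hstrict : ∀ x ∈ ball x₀ r, ∀ l : ℝ, 1 < l → l < 1 + δ →
      (1 - l⁻¹) * η ≤ K (l⁻¹ • x) - K x)
    (hB : IntegrableOn (fun x => Real.exp (n * w x)) (ball x₀ r)) :
    c / 2 * (∫ x, f x) ^ 2 < ∫ x, f x := by
  set W : ℝ → 𝔼 → ℝ := fun ε => smoothedPotential f c ε with hW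
  set τ : ℝ → ℝ := fun ε => Real.exp (n * (c * κ * ε)) with hτ
  have hκ0 : 0 ≤ κ := (integral_nonneg fun _ => by positivity).trans (hκ 0)
  have hM0 : 0 ≤ M := by simpa using hM 0
  have hWsub : ∀ ε : ℝ, 0 < ε → ∀ x, |W ε x - w x| ≤ c * κ * ε := fun ε hε =>
    abs_smoothedPotential_sub_le hn hc hf hI hw hκ hε
  have hτ1 : ∀ ε : ℝ, 0 < ε → 1 ≤ τ ε := fun ε hε => Real.one_le_exp (by positivity)
  have hnn : (0 : ℝ) ≤ n := Nat.cast_nonneg n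
  have hup : ∀ ε : ℝ, 0 < ε → ∀ x, Real.exp (n * W ε x) ≤ τ ε * Real.exp (n * w x) := by
    intro ε hε x
    rw [hτ, ← Real.exp_add, ← mul_add]
    apply Real.exp_le_exp.2
    have := le_of_abs_le (hWsub ε hε x)
    exact mul_le_mul_of_nonneg_left (by linarith) hnn
  have hlow : ∀ ε : ℝ, 0 < ε → ∀ x, (τ ε)⁻¹ * Real.exp (n * w x) ≤ Real.exp (n * W ε x) := by
    intro ε hε x
    rw [hτ, ← Real.exp_neg, ← Real.exp_add]
    apply Real.exp_le_exp.2
    have := neg_le_of_abs_le (hWsub ε hε x)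
    have h2 := mul_le_mul_of_nonneg_left this hnn
    linarith
  have hdiff : ∀ ε : ℝ, 0 < ε → ∀ x, |K x * Real.exp (n * W ε x) - f x| ≤
      (τ ε - 1) * |f x| := by
    intro ε hε x
    rw [hfK, ← mul_sub, abs_mul, abs_mul, Real.abs_exp, mul_left_comm]
    refine mul_le_mul_of_nonneg_left ?_ (abs_nonneg _)
    have h1 := hup ε hε x
    have h2 := hlow ε hε x
    have h3 := hτ1 ε hε
    have hE : 0 ≤ Real.exp (n * w x) := (Real.exp_pos _).le
    -- Turns the lower factor `(τ ε)⁻¹` into `1 - (τ ε - 1)`, so one error `τ ε - 1` serves on both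
    -- sides.
    have h4 : 2 - τ ε ≤ (τ ε)⁻¹ := by
      rw [← one_div, le_div_iff₀ (by linarith)]
      nlinarith [sq_nonneg (τ ε - 1)]
    have h5 := mul_le_mul_of_nonneg_right h4 hE
    rw [abs_le]
    constructor <;> linarith
  have hWmeas : ∀ ε : ℝ, AEStronglyMeasurable (fun x : 𝔼 => Real.exp (n * W ε x)) volume :=
    fun ε => Real.continuous_exp.comp_aestronglyMeasurable
      (by simpa using (aestronglyMeasurable_smoothedPotential hf c ε 1).const_mul (n : ℝ))
  have hKWmeas : ∀ ε : ℝ, AEStronglyMeasurable (fun x : 𝔼 => K x * Real.exp (n * W ε x)) volume :=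
    fun ε => hK.aestronglyMeasurable.mul (hWmeas ε)
  have hdint : ∀ ε : ℝ, 0 < ε → Integrable fun x => K x * Real.exp (n * W ε x) - f x :=
    fun ε hε => (hf.abs.const_mul _).mono' ((hKWmeas ε).sub hf.1)
      (Eventually.of_forall (hdiff ε hε))
  have hKint : ∀ ε : ℝ, 0 < ε → Integrable fun x => K x * Real.exp (n * W ε x) := by
    intro ε hε
    refine ((hdint ε hε).add hf).congr (Eventually.of_forall fun x => ?_)
    simp
  set m := ∫ x, |f x|
  set b := ∫ x in ball x₀ r, Real.exp (n * w x)
  have hV : ∀ ε : ℝ, 0 < ε → ∀ x, |smoothedGradient f ε x x| ≤ M := fun ε hε x =>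
    (abs_smoothedGradient_le hI hε x x).trans (hM x)
  have hVmeas := fun ε => aestronglyMeasurable_smoothedGradient hf ε
  have hBmass : ∀ ε : ℝ, 0 < ε → (τ ε)⁻¹ * b ≤
      ∫ x in ball x₀ r, Real.exp (n * W ε x) := by
    intro ε hε
    rw [← integral_const_mul]
    refine integral_mono (hB.const_mul _) ?_ (hlow ε hε)
    exact Integrable.mono' (hB.const_mul (τ ε)) (hWmeas ε).restrict
      (Eventually.of_forall fun x => by
        rw [Real.norm_of_nonneg (Real.exp_pos _).le]
        exact hup ε hε x)
  have hmass : ∀ ε : ℝ, 0 < ε →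
      ∫ x, K x * Real.exp (n * W ε x) ≤ (∫ x, f x) + (τ ε - 1) * m := by
    intro ε hε
    rw [← integral_const_mul, ← integral_add hf (hf.abs.const_mul _)]
    refine integral_mono (hKint ε hε) (hf.add (hf.abs.const_mul _)) fun x => ?_
    have := le_of_abs_le (hdiff ε hε x)
    simp only
    linarith
  have hgrad : ∀ ε : ℝ, 0 < ε → (∫ x, f x * smoothedGradient f ε x x) - (τ ε - 1) * M * m ≤
      ∫ x, K x * Real.exp (n * W ε x) * smoothedGradient f ε x x := by
    intro ε hε
    have h1 : Integrable fun x => f x * smoothedGradient f ε x x :=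
      hf.mul_bdd (c := M) (hVmeas ε) (Eventually.of_forall (hV ε hε))
    have h2 : Integrable fun x => K x * Real.exp (n * W ε x) * smoothedGradient f ε x x :=
      (hKint ε hε).mul_bdd (c := M) (hVmeas ε) (Eventually.of_forall (hV ε hε))
    rw [← integral_const_mul, ← integral_sub h1 (hf.abs.const_mul _)]
    refine integral_mono (h1.sub (hf.abs.const_mul _)) h2 fun x => ?_
    have h3 : |(K x * Real.exp (n * W ε x) - f x) * smoothedGradient f ε x x| ≤
        (τ ε - 1) * |f x| * M := by
      rw [abs_mul]
      exact mul_le_mul (hdiff ε hε x) (hV ε hε x) (abs_nonneg _)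
        (mul_nonneg (by linarith [hτ1 ε hε]) (abs_nonneg _))
    have h4 := neg_le_of_abs_le h3
    simp only
    linarith
  have hτlim : Tendsto τ (𝓝[>] 0) (𝓝 1) := by
    have h : Continuous τ := by fun_prop
    have h2 := h.tendsto 0
    simp only [hτ, mul_zero, Real.exp_zero] at h2
    exact h2.mono_left nhdsWithin_le_nhds
  have hτsub : Tendsto (fun ε => τ ε - 1) (𝓝[>] 0) (𝓝 0) := by
    simpa using hτlim.sub_const 1
  have hleft := (((tendsto_integral_mul_smoothedGradient hn hf hI hM).sub
    ((hτsub.mul_const M).mul_const m)).const_mul (n * c))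
  have hright := ((hτsub.mul_const m).const_add (∫ x, f x)).const_mul (n : ℝ) |>.sub
    (((hτlim.inv₀ one_ne_zero).mul_const b).const_mul η)
  -- The gain `η b` has a positive limit as `ε → 0`, so strictness survives.
  have hlimit := le_of_tendsto_of_tendsto hleft hright (by
    filter_upwards [self_mem_nhdsWithin] with ε hε
    have h := smoothed_pohozaev hn hc hf hI hw hκ hM hK hfK hmono hδ hstrict hB hε
    have h1 := mul_le_mul_of_nonneg_left (hgrad ε hε) (show 0 ≤ n * c by positivity)
    have h2 := mul_le_mul_of_nonneg_left (hmass ε hε) hnn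
    have h3 := mul_le_mul_of_nonneg_left (hBmass ε hε) hη.le
    exact (h1.trans h).trans (by linarith))
  have hb : 0 < b := by
    have : NeZero (volume.restrict (ball x₀ r)) := ⟨by
      rw [Ne, Measure.restrict_eq_zero]
      exact (measure_ball_pos _ _ hr).ne'⟩
    exact integral_exp_pos hB
  have hn0 : (0 : ℝ) < n := by exact_mod_cast (show 0 < n by omega)
  have hηb := mul_pos hη hb
  have hfin : (n : ℝ) * (c / 2 * (∫ x, f x) ^ 2) < n * ∫ x, f x := by
    simp only [zero_mul, sub_zero, add_zero, inv_one, one_mul] at hlimit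
    linarith
  exact lt_of_mul_lt_mul_left hfin hn0.le

/-! ### Consequences of radial monotonicity and of the cone condition. -/

lemma unitSphereVolume_pos (n : ℕ) : 0 < unitSphereVolume n := by
  rw [unitSphereVolume, Measure.toSphere_real_apply_univ, finrank_euclideanSpace_fin]
  have : 0 < volume.real (ball (0 : EuclideanSpace ℝ (Fin (n + 1))) 1) := by
    rw [Measure.real, ENNReal.toReal_pos_iff]
    exact ⟨measure_ball_pos _ _ one_pos, measure_ball_lt_top⟩
  positivity

lemma hasDerivAt_comp_ray {K : 𝔼 → ℝ} (hK : ContDiff ℝ 1 K) (x : 𝔼) (s : ℝ) :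
    HasDerivAt (fun s : ℝ => K (s • x)) (fderiv ℝ K (s • x) x) s := by
  have h1 : HasDerivAt (fun s : ℝ => s • x) x s := by
    simpa using (hasDerivAt_id s).smul_const x
  exact ((hK.differentiable one_ne_zero) (s • x)).hasFDerivAt.comp_hasDerivAt s h1

lemma radial_antitone {K : 𝔼 → ℝ} (hK : ContDiff ℝ 1 K) (h : ∀ x, fderiv ℝ K x x ≤ 0) (x : 𝔼) :
    AntitoneOn (fun s : ℝ => K (s • x)) (Ici 0) := by
  refine antitoneOn_of_deriv_nonpos (convex_Ici 0)
    (fun s _ => (hasDerivAt_comp_ray hK x s).continuousAt.continuousWithinAt)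
    (fun s _ => (hasDerivAt_comp_ray hK x s).differentiableAt.differentiableWithinAt) ?_
  intro s hs
  rw [interior_Ici, mem_Ioi] at hs
  rw [(hasDerivAt_comp_ray hK x s).deriv]
  have h1 := h (s • x)
  rw [map_smul, smul_eq_mul] at h1
  exact nonpos_of_mul_nonpos_right h1 hs

/-- A radially nonincreasing `C¹` function which is not constant along some ray decreases
at a definite rate under dilations of some ball. -/
lemma exists_strict_radial_decrease {K : 𝔼 → ℝ} (hK : ContDiff ℝ 1 K)
    (h : ∀ x, fderiv ℝ K x x ≤ 0) {x₁ : 𝔼} (hx₁ : K x₁ ≠ K 0) :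
    ∃ (x₀ : 𝔼) (r η δ : ℝ), 0 < r ∧ 0 < η ∧ 0 < δ ∧ ∀ x ∈ ball x₀ r, ∀ l : ℝ, 1 < l → l < 1 + δ →
      (1 - l⁻¹) * η ≤ K (l⁻¹ • x) - K x := by
  obtain ⟨x₀, hx₀⟩ : ∃ x₀, fderiv ℝ K x₀ x₀ < 0 := by
    by_contra! hcon
    have h1 := radial_antitone hK h x₁ (mem_Ici.2 le_rfl) (mem_Ici.2 zero_le_one) zero_le_one
    have h2 := radial_antitone (K := fun x => -K x) hK.neg (fun x => by
      rw [fderiv_fun_neg, neg_apply]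
      linarith [hcon x]) x₁ (mem_Ici.2 le_rfl) (mem_Ici.2 zero_le_one) zero_le_one
    simp only [one_smul, zero_smul] at h1 h2
    exact hx₁ (by linarith)
  set η := -fderiv ℝ K x₀ x₀ / 2 with hη
  have hη0 : 0 < η := by linarith
  have hcont : Continuous fun x => fderiv ℝ K x x :=
    (hK.continuous_fderiv one_ne_zero).clm_apply continuous_id
  obtain ⟨ρ, hρ, hρK⟩ := Metric.eventually_nhds_iff_ball.1
    (hcont.continuousAt.eventually_lt_const (show fderiv ℝ K x₀ x₀ < -η by linarith))
  -- This `δ` makes `|(1 - s) x| ≤ ρ/2` for `s` between `l⁻¹` and 1, keeping `s x` in the ball where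
  -- the radial derivative is below `-η`.
  refine ⟨x₀, ρ / 2, η, ρ / 2 / (‖x₀‖ + ρ), by positivity, hη0, by positivity, ?_⟩
  intro x hx l hl1 hl2
  have hl0 : 0 < l := by linarith
  have hlinv : l⁻¹ < 1 := inv_lt_one_of_one_lt₀ hl1
  have hlinv0 : 0 < l⁻¹ := by positivity
  obtain ⟨s, hs, hslope⟩ := exists_hasDerivAt_eq_slope (fun s : ℝ => K (s • x))
    (fun s => fderiv ℝ K (s • x) x) hlinv
    (fun s _ => (hasDerivAt_comp_ray hK x s).continuousAt.continuousWithinAt)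
    (fun s _ => hasDerivAt_comp_ray hK x s)
  have hs0 : 0 < s := hlinv0.trans hs.1
  have hmem : s • x ∈ ball x₀ ρ := by
    rw [mem_ball, dist_eq_norm] at hx ⊢
    have e : s • x - x₀ = (x - x₀) - (1 - s) • x := by
      rw [sub_smul, one_smul]
      abel
    have hxn : ‖x‖ < ‖x₀‖ + ρ := by
      have := norm_sub_norm_le x x₀
      linarith
    have h1 : 1 - s < l - 1 := by
      have : 1 - l⁻¹ ≤ l - 1 := by
        have h2 := mul_inv_cancel₀ hl0.ne'
        nlinarith
      linarith [hs.1]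
    have h3 : (1 - s) * ‖x‖ ≤ ρ / 2 / (‖x₀‖ + ρ) * (‖x₀‖ + ρ) := by
      apply mul_le_mul (by linarith) hxn.le (norm_nonneg _) (by positivity)
    rw [div_mul_cancel₀ _ (by positivity)] at h3
    have h4 := norm_sub_le (x - x₀) ((1 - s) • x)
    rw [norm_smul, Real.norm_of_nonneg (by linarith [hs.2])] at h4
    rw [e]
    linarith
  have h1 := hρK _ hmem
  rw [map_smul, smul_eq_mul] at h1
  -- The known bound is for `s` times this derivative; dividing by `s < 1` only makes it more
  -- negative.
  have h2 : fderiv ℝ K (s • x) x ≤ -η := by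
    by_contra! hcon
    have : s * -η < s * fderiv ℝ K (s • x) x := mul_lt_mul_of_pos_left hcon hs0
    nlinarith [hs.2]
  simp only [one_smul] at hslope
  rw [hslope, div_le_iff₀ (by linarith)] at h2
  linarith

/-- Inside a cone there is a ball all of whose dilates stay in the cone. -/
lemma exists_ball_subset_solidCone {e : 𝔼} (he : e ≠ 0) {θ : ℝ} (hθ : 0 < θ) :
    ∃ (z₀ : 𝔼) (r : ℝ), 0 < r ∧ ∀ z ∈ ball z₀ r, 1 ≤ ‖z‖ ∧ ‖z‖ ≤ 2 ∧
      ∀ R : ℝ, 0 < R → R • z ∈ solidCone e θ := by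
  have he0 : 0 < ‖e‖ := norm_pos_iff.2 he
  set z₀ : 𝔼 := (3 / 2 * ‖e‖⁻¹) • e with hz₀
  have hpos : 0 < 3 / 2 * ‖e‖⁻¹ := by positivity
  have hnorm : ‖z₀‖ = 3 / 2 := by
    rw [hz₀, norm_smul, Real.norm_of_nonneg hpos.le, mul_assoc, inv_mul_cancel₀ he0.ne', mul_one]
  have hz0 : z₀ ≠ 0 := norm_pos_iff.1 (by rw [hnorm]; norm_num)
  have hang : ContinuousAt (fun z => InnerProductGeometry.angle e z) z₀ :=
    ContinuousAt.comp (f := fun z : 𝔼 => (e, z)) (x := z₀)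
      (InnerProductGeometry.continuousAt_angle (x := (e, z₀)) he hz0)
      (by fun_prop)
  have h0 : InnerProductGeometry.angle e z₀ < θ := by
    rw [hz₀, InnerProductGeometry.angle_smul_right_of_pos _ _ hpos,
      InnerProductGeometry.angle_self he]
    exact hθ
  obtain ⟨ρ, hρ, hρang⟩ := Metric.eventually_nhds_iff_ball.1 (hang.eventually_lt_const h0)
  -- The centre has norm `3/2`, so radius at most `1/2` keeps norms in `[1, 2]`.
  refine ⟨z₀, min ρ (1 / 2), lt_min hρ (by norm_num), fun z hz => ?_⟩
  have hz1 : dist z z₀ < ρ := lt_of_lt_of_le hz (min_le_left _ _)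
  have hz2 : dist z z₀ < 1 / 2 := lt_of_lt_of_le hz (min_le_right _ _)
  rw [dist_eq_norm] at hz2
  have a1 := norm_sub_norm_le z z₀
  have a2 := norm_sub_norm_le z₀ z
  rw [norm_sub_rev] at a2
  have hzn : 1 ≤ ‖z‖ := by linarith
  refine ⟨hzn, by linarith, fun R hR => ⟨?_, ?_⟩⟩
  · exact smul_ne_zero hR.ne' (norm_pos_iff.1 (by linarith))
  · rw [InnerProductGeometry.angle_smul_right_of_pos _ _ hR]
    exact hρang z hz1

lemma aestronglyMeasurable_log_potential {f : 𝔼 → ℝ} (hf : Integrable f) :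
    AEStronglyMeasurable (fun x : 𝔼 => ∫ y, Real.log (‖y‖ / ‖x - y‖) * f y) volume := by
  have h : AEStronglyMeasurable (fun p : 𝔼 × 𝔼 => Real.log (‖p.2‖ / ‖p.1 - p.2‖) * f p.2)
      (volume.prod volume) :=
    (Measurable.aestronglyMeasurable (by fun_prop)).mul hf.aestronglyMeasurable.comp_snd
  exact h.integral_prod_right'

/-- If `w ≤ D - a log |x|` at infinity with `γ + n ≤ n a`, then `K e^{nw}` is bounded and decays
like `|x|^{-n}`. -/
lemma density_decay (hn : 2 ≤ n) {f w K : 𝔼 → ℝ} (hK : Continuous K)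
    (hfK : ∀ x, f x = K x * Real.exp (n * w x)) {C : ℝ} (hC : ∀ᵐ x, w x ≤ C)
    {R₁ γ c₂ a D : ℝ} (hc₂ : 0 < c₂) (hup : ∀ x, R₁ ≤ ‖x‖ → |K x| ≤ c₂ * ‖x‖ ^ γ)
    (ha : γ + n ≤ n * a) (hD : ∀ x : 𝔼, 3 ≤ ‖x‖ → w x ≤ D - a * Real.log ‖x‖) :
    ∃ A B : ℝ, (∀ᵐ x, |f x| ≤ A) ∧ ∀ᵐ x, |f x| ≤ B * (‖x‖ ^ n)⁻¹ := by
  set ρ := max R₁ 3 with hρ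
  have hρ3 : 3 ≤ ρ := le_max_right _ _
  have hnn : (0 : ℝ) ≤ n := Nat.cast_nonneg n
  obtain ⟨k, hk⟩ := (isCompact_closedBall (0 : 𝔼) ρ).exists_bound_of_continuousOn hK.continuousOn
  have hk0 : 0 ≤ k := (norm_nonneg _).trans (hk 0 (by simpa using (by linarith : 0 ≤ ρ)))
  have hnear : ∀ᵐ x, ‖x‖ ≤ ρ → |f x| ≤ k * Real.exp (n * C) := by
    filter_upwards [hC] with x hx hxρ
    rw [hfK, abs_mul, Real.abs_exp]
    have := hk x (by simpa using hxρ)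
    rw [Real.norm_eq_abs] at this
    gcongr
  have hfar : ∀ x : 𝔼, ρ < ‖x‖ → |f x| ≤ c₂ * Real.exp (n * D) * (‖x‖ ^ n)⁻¹ := by
    intro x hx
    have hx3 : 3 ≤ ‖x‖ := by linarith
    have hx0 : 0 < ‖x‖ := by linarith
    have hlog : 0 ≤ Real.log ‖x‖ := Real.log_nonneg (by linarith)
    rw [hfK, abs_mul, Real.abs_exp]
    have h1 := hup x ((le_max_left _ _).trans hx.le)
    have h2 : ‖x‖ ^ γ * Real.exp (n * w x) ≤ Real.exp (n * D) * (‖x‖ ^ n)⁻¹ := by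
      rw [← Real.rpow_natCast, ← Real.rpow_neg hx0.le, Real.rpow_def_of_pos hx0,
        Real.rpow_def_of_pos hx0, ← Real.exp_add, ← Real.exp_add]
      apply Real.exp_le_exp.2
      have h3 := mul_le_mul_of_nonneg_left (hD x hx3) hnn
      have h4 := mul_le_mul_of_nonneg_right ha hlog
      linarith
    calc |K x| * Real.exp (n * w x) ≤ c₂ * ‖x‖ ^ γ * Real.exp (n * w x) := by gcongr
      _ = c₂ * (‖x‖ ^ γ * Real.exp (n * w x)) := by ring
      _ ≤ c₂ * (Real.exp (n * D) * (‖x‖ ^ n)⁻¹) := by gcongr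
      _ = _ := by ring
  refine ⟨k * Real.exp (n * C) + c₂ * Real.exp (n * D),
    k * Real.exp (n * C) * ρ ^ n + c₂ * Real.exp (n * D), ?_, ?_⟩
  · filter_upwards [hnear] with x hx
    have p1 : 0 ≤ k * Real.exp (n * C) := by positivity
    have p2 : 0 ≤ c₂ * Real.exp (n * D) := by positivity
    rcases le_or_gt ‖x‖ ρ with h | h
    · linarith [hx h]
    · have h1 : (‖x‖ ^ n)⁻¹ ≤ 1 := inv_le_one_of_one_le₀ (one_le_pow₀ (by linarith))
      have h2 := mul_le_mul_of_nonneg_left h1 p2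
      linarith [hfar x h]
  · filter_upwards [hnear, ae_ne_point hn 0] with x hx hx0
    have hx0' : 0 < ‖x‖ := norm_pos_iff.2 hx0
    have p2 : 0 ≤ c₂ * Real.exp (n * D) * (‖x‖ ^ n)⁻¹ := by positivity
    have p1 : 0 ≤ k * Real.exp (n * C) := by positivity
    rw [add_mul]
    rcases le_or_gt ‖x‖ ρ with h | h
    · have h1 : 1 ≤ ρ ^ n * (‖x‖ ^ n)⁻¹ := by
        rw [← div_eq_mul_inv, one_le_div (by positivity)]
        gcongr
      have h2 := mul_le_mul_of_nonneg_left h1 p1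
      linarith [hx h]
    · have : 0 ≤ k * Real.exp (n * C) * ρ ^ n * (‖x‖ ^ n)⁻¹ := by positivity
      linarith [hfar x h]

end

/-! ### The contradiction between the two mass bounds. -/

theorem corollary2p4 (n : ℕ) (hn : 2 ≤ n) (K : EuclideanSpace ℝ (Fin n) → ℝ)
    (hK : ContDiff ℝ 1 K) (hPCC : PolynomialConeCondition K)
    (hrad : ∀ x, inner ℝ x (gradient K x) ≤ 0) :
    ¬ ∃ w : EuclideanSpace ℝ (Fin n) → ℝ,
        LocallyEssentiallyBounded w ∧
        (∃ C : ℝ, ∀ᵐ x, w x ≤ C) ∧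
        Integrable (fun x => K x * Real.exp (n * w x)) ∧
        SolvesIntegralEquation K w := by
  rintro ⟨v, -, ⟨C, hvC⟩, hvint, hsol⟩
  obtain ⟨R₁, θ, γ, c₁, c₂, hR₁, hθ, hγ, hc₁, hc₂, hup, e, he, hcone⟩ := hPCC
  have hfd : ∀ x, fderiv ℝ K x x ≤ 0 := fun x => by
    have h := hrad x
    rwa [real_inner_comm, gradient, InnerProductSpace.toDual_symm_apply] at h
  have hn2 : (2 : ℝ) ≤ n := by exact_mod_cast hn
  have hKc : Continuous K := hK.continuous
  set c := 2 / unitSphereVolume n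
  have hc : 0 < c := div_pos two_pos (unitSphereVolume_pos n)
  -- replace `v` by the right-hand side of the equation, which is defined everywhere
  set w : EuclideanSpace ℝ (Fin n) → ℝ := fun x =>
    c * ∫ y, Real.log (‖y‖ / ‖x - y‖) * (K y * Real.exp (n * v y))
  have hvw : v =ᵐ[volume] w := hsol
  set f : EuclideanSpace ℝ (Fin n) → ℝ := fun x => K x * Real.exp (n * w x) with hf_def
  have hvf : (fun x => K x * Real.exp (n * v x)) =ᵐ[volume] f := by
    filter_upwards [hvw] with x hx
    rw [hf_def, hx]
  have hf : Integrable f := hvint.congr hvf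
  have hw : ∀ x, w x = c * ∫ y, Real.log (‖y‖ / ‖x - y‖) * f y := by
    intro x
    refine congrArg (fun t => c * t) (integral_congr_ae ?_)
    filter_upwards [hvf] with y hy
    exact congrArg (fun t => Real.log (‖y‖ / ‖x - y‖) * t) hy
  have hC : ∀ᵐ x, w x ≤ C := by
    filter_upwards [hvC, hvw] with x h1 h2
    rwa [← h2]
  have hfK : ∀ x, f x = K x * Real.exp (n * w x) := fun _ => rfl
  have hI : ∀ x, Integrable (fun y => ‖x - y‖⁻¹ * |f y|) := by
    intro x
    obtain ⟨k, hk⟩ := (isCompact_closedBall x 1).exists_bound_of_continuousOn hKc.continuousOn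
    refine (inv_norm_potential_bound hn hf x (M := |k| * Real.exp (n * C)) one_pos ?_).1
    filter_upwards [hC] with y hy hyx
    rw [hfK, abs_mul, Real.abs_exp]
    have := (hk y (ball_subset_closedBall hyx)).trans (le_abs_self k)
    rw [Real.norm_eq_abs] at this
    gcongr
  have hK0 : ∀ x, K x ≤ K 0 := fun x => by
    have h := radial_antitone hK hfd x (mem_Ici.2 le_rfl) (mem_Ici.2 zero_le_one) zero_le_one
    simpa using h
  have hmono : ∀ (x : EuclideanSpace ℝ (Fin n)) (l : ℝ), 1 ≤ l → K x ≤ K (l⁻¹ • x) := by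
    intro x l hl
    have h := radial_antitone hK hfd x (mem_Ici.2 (inv_nonneg.2 (by linarith)))
      (mem_Ici.2 zero_le_one) (inv_le_one_of_one_le₀ hl)
    simpa using h
  have hP : ∀ y, max (f y) 0 ≤ |K 0| * Real.exp (n * w y) := by
    intro y
    refine max_le ?_ (by positivity)
    rw [hfK]
    exact mul_le_mul_of_nonneg_right ((hK0 y).trans (le_abs_self _)) (Real.exp_pos _).le
  have hG : ∀ᵐ y, max (f y) 0 ≤ |K 0| * Real.exp (n * C) := by
    filter_upwards [hC] with y hy
    refine (hP y).trans ?_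
    gcongr
  obtain ⟨z₀, r, hr, hball⟩ := exists_ball_subset_solidCone he hθ
  have hKgrow : ∀ R : ℝ, R₁ ≤ R → ∀ z ∈ ball z₀ r, c₁ * R ^ γ ≤ |K (R • z)| := by
    intro R hR z hz
    obtain ⟨hz1, -, hzc⟩ := hball z hz
    have hR0 : 0 < R := by linarith
    have hRz : R ≤ ‖R • z‖ := by
      rw [norm_smul, Real.norm_of_nonneg hR0.le]
      exact le_mul_of_one_le_right hR0.le hz1
    refine le_trans ?_ (hcone (R • z) ⟨hzc R hR0, ?_⟩)
    · have hγ0 : 0 ≤ γ := by linarith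
      gcongr
    · rw [mem_ball, dist_zero_right, not_lt]
      linarith
  have hmass := growth_le_total_mass hn hc hf hI hw hr (fun z hz => (hball z hz).2.1) hc₁
    (γ := γ) (R₁ := R₁) (fun R hR z hz => by
      rw [hfK, abs_mul, Real.abs_exp]
      exact mul_le_mul_of_nonneg_right (hKgrow R hR z hz) (Real.exp_pos _).le)
  have ha : 2 ≤ c * ∫ y, f y := by
    have : (n : ℝ) * 2 ≤ n * (c * ∫ y, f y) := by linarith
    exact le_of_mul_le_mul_left this (by linarith)
  obtain ⟨D, hD⟩ := log_potential_decay hn hc hf hI hw hG hP ha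
  obtain ⟨A, B, hA, hB⟩ := density_decay hn hKc hfK hC hc₂ hup hmass hD
  have hκ := fun x => (inv_norm_potential_bound hn hf x (r := 1) one_pos
    (hA.mono fun y hy _ => hy)).2
  have hM := norm_mul_inv_norm_potential_le hn hf hB
  obtain ⟨x₁, hx₁⟩ : ∃ x₁, K x₁ ≠ K 0 := by
    by_contra! hcon
    -- If `K` were constant, growth at this `R` would give `|K 0| + 1 ≤ c₁ R ≤ c₁ R^γ ≤ |K 0|`.
    set R := max (max R₁ 1) ((|K 0| + 1) / c₁)
    have hR1 : 1 ≤ R := (le_max_right _ _).trans (le_max_left _ _)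
    have h1 := hKgrow R ((le_max_left _ _).trans (le_max_left _ _)) z₀ (mem_ball_self hr)
    rw [hcon] at h1
    have h2 : R ≤ R ^ γ := by
      simpa using Real.rpow_le_rpow_of_exponent_le hR1 (show (1 : ℝ) ≤ γ by linarith)
    have h3 : (|K 0| + 1) / c₁ ≤ R := le_max_right _ _
    rw [div_le_iff₀ hc₁] at h3
    have h4 := mul_le_mul_of_nonneg_left h2 hc₁.le
    linarith
  obtain ⟨x₀, ρ, η, δ, hρ, hη, hδ, hstrict⟩ := exists_strict_radial_decrease hK hfd hx₁
  have hexp : IntegrableOn (fun x => Real.exp (n * w x)) (ball x₀ ρ) := by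
    have hconst : IntegrableOn (fun _ : EuclideanSpace ℝ (Fin n) => Real.exp (n * C))
        (ball x₀ ρ) := integrableOn_const measure_ball_lt_top.ne
    refine Integrable.mono' hconst ?_ (ae_restrict_of_ae ?_)
    · have hwm : AEStronglyMeasurable w volume :=
        (aestronglyMeasurable_log_potential hvint).const_mul c
      exact (Real.continuous_exp.comp_aestronglyMeasurable (hwm.const_mul (n : ℝ))).restrict
    · filter_upwards [hC] with x hx
      rw [Real.norm_of_nonneg (Real.exp_pos _).le]
      gcongr
  have hfinal := total_mass_lt_of_radially_decreasing hn hc hf hI hw hκ hM hKc hfK hmono hρ hη hδ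
    hstrict hexp
  have hpos : 0 < ∫ y, f y := by
    have : 0 < c * ∫ y, f y := by linarith
    exact (mul_pos_iff_of_pos_left hc).1 this
  -- Dividing `c/2 (∫ f)² < ∫ f` by `∫ f > 0` gives `c ∫ f < 2`, against `ha`.
  nlinarith
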